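/- Let $G$ be a second countable locally compact (Hausdorff) group. For $1<p<\infty$ let $\ell_p=\ell_p(\mathbf N)$ be the Banach space of complex $p$-summable sequences. An orthogonal representation of $G$ on $\ell_p$ is a homomorphism $\pi$ from $G$ to the group of bijective linear isometries of $\ell_p$ such that $g\mapsto\pi(g)f$ is continuous for every $f\in\ell_p$. Let $\pi^*$ be the dual representation on the dual space $\ell_p^*=\ell_q$, $\tfrac1p+\tfrac1q=1$, and let $\ell_p'(\pi)\subset\ell_p$ be the annihilator of the space of $\pi^*(G)$-invariant vectors of $\ell_q$. A sequence of almost invariant vectors for an isometric representation $\pi$ is a sequence of vectors $f_n$ with $\|f_n\|=1$ and $\|\pi(g)f_n-f_n\|\to 0$ uniformly for $g$ in compact subsets of $G$. The group $G$ has Property $(T_{\ell_p})$ if for no orthogonal representation $\pi$ of $G$ on $\ell_p$ there is a sequence of almost invariant vectors in $\ell_p'(\pi)$. For a family $\mathcal R$ of unitary representations of $G$, the group $G$ has Property $(T;\mathcal R)$ if the direct sum $\bigoplus_{\pi\in\mathcal R}\pi'$ has no sequence of almost invariant vectors, where $\pi'$ is the restriction of $\pi$ to the orthogonal complement of its invariant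 vectors. Let $\mathcal R_{\rm mon}$ be the family of all monomial representations ${\rm Ind}_H^G\chi$, where $H$ is an open subgroup of $G$ and $\chi:H\to\mathbf S^1$ is a (continuous) unitary character: $G$ acts by left translations on the Hilbert space of the functions $\xi:G\to\mathbf C$ with $\xi(yh)=\chi(h)^{-1}\xi(y)$ for $y\in G$, $h\in H$, and $\sum_{yH\in G/H}|\xi(y)|^2<\infty$. Theorem. The following are equivalent: (i) $G$ has Property $(T_{\ell_p})$ for some $1<p<\infty$, $p\neq 2$; (ii) $G$ has Property $(T;\mathcal R_{\rm mon})$. Moreover, for all $p,q\in(1,\infty)\setminus\{2\}$, $G$ has Property $(T_{\ell_p})$ if and only if it has Property $(T_{\ell_q})$. -/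

import Mathlib

open Filter Topology
open scoped ENNReal

noncomputable section

namespace GroupRep

/-! ### Representations by linear isometries -/

/-- A continuous representation of `G` on a complex normed space `E` by bijective linear
isometries: a homomorphism `π` from `G` to the group of bijective linear isometries of `E` such
that `g ↦ π g v` is continuous for every vector `v`. For `E = ℓ_p` this is an orthogonal
representation, for `E` a Hilbert space it is a unitary representation. -/
structure IsomRep (G : Type*) [Group G] [TopologicalSpace G]
    (E : Type*) [NormedAddCommGroup E] [NormedSpace ℂ E] where
  toHom : G →* (E ≃ₗᵢ[ℂ] E)
  continuous_apply : ∀ v : E, Continuous fun g : G => toHom g v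

/-- The subspace of vectors fixed by the group. -/
def invariants {G : Type*} [Group G] {E : Type*} [NormedAddCommGroup E] [NormedSpace ℂ E]
    (π : G →* (E ≃ₗᵢ[ℂ] E)) : Submodule ℂ E where
  carrier := {v | ∀ g, π g v = v}
  add_mem' := fun ha hb g => by rw [map_add, ha g, hb g]
  zero_mem' := fun g => map_zero _
  smul_mem' := fun c v hv g => by rw [map_smul, hv g]

/-- There is a sequence of almost invariant vectors for `π` in the subspace `S`: unit vectors
`f n ∈ S` with `‖π g (f n) - f n‖ → 0` uniformly for `g` in compact subsets of `G`. -/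
def HasAlmostInvariantVectorsIn {G : Type*} [Group G] [TopologicalSpace G]
    {E : Type*} [NormedAddCommGroup E] [NormedSpace ℂ E]
    (π : G →* (E ≃ₗᵢ[ℂ] E)) (S : Submodule ℂ E) : Prop :=
  ∃ f : ℕ → E, (∀ n, f n ∈ S) ∧ (∀ n, ‖f n‖ = 1) ∧
    ∀ K : Set G, IsCompact K →
      TendstoUniformlyOn (fun n g => ‖π g (f n) - f n‖) (fun _ => (0 : ℝ)) atTop K

/-! ### Property `(T_B)` and Property `(T_{ℓ_p})` -/

/-- The transpose inverse of a linear isometry `e`: the isometry `φ ↦ φ ∘ e⁻¹` of the dual. -/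
def dualIsom {E : Type*} [NormedAddCommGroup E] [NormedSpace ℂ E]
    (e : E ≃ₗᵢ[ℂ] E) : StrongDual ℂ E ≃ₗᵢ[ℂ] StrongDual ℂ E where
  toFun φ := φ.comp (e.symm.toContinuousLinearEquiv : E →L[ℂ] E)
  invFun φ := φ.comp (e.toContinuousLinearEquiv : E →L[ℂ] E)
  map_add' _ _ := by ext; simp
  map_smul' _ _ := by ext; simp
  left_inv _ := by ext; simp
  right_inv _ := by ext; simp
  norm_map' φ := ContinuousLinearMap.opNorm_comp_linearIsometryEquiv φ e.symm

/-- The dual representation `π*` on the (strong) dual space, `π* g φ = φ ∘ π g⁻¹`. For `E = ℓ_p`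
with `1 < p < ∞`, the dual space is `ℓ_q` with `q` the conjugate exponent. -/
def dualRep {G : Type*} [Group G] {E : Type*} [NormedAddCommGroup E] [NormedSpace ℂ E]
    (π : G →* (E ≃ₗᵢ[ℂ] E)) : G →* (StrongDual ℂ E ≃ₗᵢ[ℂ] StrongDual ℂ E) where
  toFun g := dualIsom (π g)
  map_one' := by ext; simp [dualIsom, LinearIsometryEquiv.one_def]
  map_mul' a b := by ext; simp [dualIsom, LinearIsometryEquiv.mul_def]

/-- The complement `E'(π)` of the invariant vectors: the annihilator in `E` of the space of
vectors of the dual space which are invariant under the dual representation. -/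
def invariantComplement {G : Type*} [Group G]
    {E : Type*} [NormedAddCommGroup E] [NormedSpace ℂ E]
    (π : G →* (E ≃ₗᵢ[ℂ] E)) : Submodule ℂ E where
  carrier := {v | ∀ φ ∈ invariants (dualRep π), φ v = 0}
  add_mem' := fun ha hb φ hφ => by rw [map_add, ha φ hφ, hb φ hφ, add_zero]
  zero_mem' := fun φ _ => map_zero φ
  smul_mem' := fun c v hv φ hφ => by rw [map_smul, hv φ hφ, smul_zero]

/-- Property `(T_B)`: no representation of `G` on `B` by linear isometries has a sequence of
almost invariant vectors in the complement of the invariant vectors. -/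
def PropertyTB (G : Type*) [Group G] [TopologicalSpace G]
    (B : Type*) [NormedAddCommGroup B] [NormedSpace ℂ B] : Prop :=
  ∀ π : IsomRep G B, ¬ HasAlmostInvariantVectorsIn π.toHom (invariantComplement π.toHom)

/-- Property `(T_{ℓ_p})`, where `ℓ_p = ℓ_p(ℕ)` is the space of complex `p`-summable sequences. -/
def PropertyTlp (G : Type*) [Group G] [TopologicalSpace G] (p : ℝ≥0∞) [Fact (1 ≤ p)] : Prop :=
  PropertyTB G (lp (fun _ : ℕ => ℂ) p)

/-! ### Property `(T; R)` for a family of unitary representations -/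

/-- The restriction of a unitary representation to the orthogonal complement of the invariant
vectors. -/
def restrictPerp {G : Type*} [Group G] {E : Type*} [NormedAddCommGroup E] [InnerProductSpace ℂ E]
    (π : G →* (E ≃ₗᵢ[ℂ] E)) :
    G →* ((invariants π)ᗮ ≃ₗᵢ[ℂ] (invariants π)ᗮ) :=
  have key : ∀ g : G, ∀ v ∈ (invariants π)ᗮ, π g v ∈ (invariants π)ᗮ := fun g v hv w hw => by
    rw [← hw g, LinearIsometryEquiv.inner_map_map]
    exact hv w hw
  { toFun := fun g =>
      { toFun := fun v => ⟨π g v, key g v v.2⟩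
        invFun := fun v => ⟨π g⁻¹ v, key g⁻¹ v v.2⟩
        map_add' := fun _ _ => Subtype.ext (map_add (π g) _ _)
        map_smul' := fun _ _ => Subtype.ext (map_smul (π g) _ _)
        left_inv := fun v => Subtype.ext (by
          change (π g⁻¹ * π g) (v : E) = v
          rw [← map_mul, inv_mul_cancel, map_one]; rfl)
        right_inv := fun v => Subtype.ext (by
          change (π g * π g⁻¹) (v : E) = v
          rw [← map_mul, mul_inv_cancel, map_one]; rfl)
        norm_map' := fun v => (π g).norm_map v }
    map_one' := by ext v; simp
    map_mul' := fun a b => by ext v; simp }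

/-- The diagonal isometry of a Hilbert sum given by isometries of the summands. -/
def directSumIsom {ι : Type*} {E : ι → Type*} [∀ i, NormedAddCommGroup (E i)]
    [∀ i, InnerProductSpace ℂ (E i)] (e : ∀ i, E i ≃ₗᵢ[ℂ] E i) : lp E 2 ≃ₗᵢ[ℂ] lp E 2 where
  toFun v := ⟨fun i => e i (v i),
    (lp.memℓp v).mono' fun i => ((e i).norm_map (v i)).le⟩
  invFun v := ⟨fun i => (e i).symm (v i),
    (lp.memℓp v).mono' fun i => ((e i).symm.norm_map (v i)).le⟩
  map_add' _ _ := lp.ext (funext fun i => map_add (e i) _ _)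
  map_smul' _ _ := lp.ext (funext fun i => map_smul (e i) _ _)
  left_inv _ := lp.ext (funext fun i => (e i).symm_apply_apply _)
  right_inv _ := lp.ext (funext fun i => (e i).apply_symm_apply _)
  norm_map' v := by
    rw [lp.norm_eq_tsum_rpow (by norm_num), lp.norm_eq_tsum_rpow (by norm_num)]
    congr 1
    exact tsum_congr fun i => congrArg (· ^ _) ((e i).norm_map (v i))

/-- The Hilbert direct sum of a family of unitary representations. -/
def directSum {G : Type*} [Group G] {ι : Type*} {E : ι → Type*} [∀ i, NormedAddCommGroup (E i)]
    [∀ i, InnerProductSpace ℂ (E i)] (π : ∀ i, G →* (E i ≃ₗᵢ[ℂ] E i)) :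
    G →* (lp E 2 ≃ₗᵢ[ℂ] lp E 2) where
  toFun g := directSumIsom fun i => π i g
  map_one' := LinearIsometryEquiv.ext fun v => lp.ext (funext fun i => by
    change π i 1 (v i) = v i
    rw [map_one]; rfl)
  map_mul' a b := LinearIsometryEquiv.ext fun v => lp.ext (funext fun i => by
    change π i (a * b) (v i) = π i a (π i b (v i))
    rw [map_mul]; rfl)

/-- Property `(T; R)` for a family `R = (π i)` of unitary representations: the direct sum of the
restrictions `π i'` of the `π i` to the orthogonal complements of their invariant vectors has no
sequence of almost invariant vectors. -/
def PropertyTR (G : Type*) [Group G] [TopologicalSpace G] {ι : Type*} {E : ι → Type*}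
    [∀ i, NormedAddCommGroup (E i)] [∀ i, InnerProductSpace ℂ (E i)]
    [∀ i, CompleteSpace (E i)] (π : ∀ i, IsomRep G (E i)) : Prop :=
  ¬ HasAlmostInvariantVectorsIn (directSum fun i => restrictPerp (π i).toHom) ⊤

/-! ### Monomial representations associated to open subgroups -/

section Monomial

variable {G : Type*} [Group G] [TopologicalSpace G] {H : OpenSubgroup G}

/-- The functions `ξ : G → ℂ` with `ξ (y h) = χ(h)⁻¹ ξ y` for `h ∈ H` for which `|ξ|²`, which is
constant on the left cosets of `H`, is summable over `G ⧸ H`. -/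
def indSubmodule (χ : H →ₜ* Circle) : Submodule ℂ (G → ℂ) where
  carrier := {ξ | (∀ (y : G) (h : H), ξ (y * h) = ((χ h)⁻¹ : Circle) * ξ y) ∧
    Memℓp (fun x : G ⧸ (H : Subgroup G) => ξ x.out) 2}
  add_mem' := fun ha hb =>
    ⟨fun y h => by simp only [Pi.add_apply, ha.1, hb.1, mul_add], ha.2.add hb.2⟩
  zero_mem' := ⟨fun y h => by simp, zero_memℓp⟩
  smul_mem' := fun c ξ hξ =>
    ⟨fun y h => by simp only [Pi.smul_apply, smul_eq_mul, hξ.1]; ring, hξ.2.const_smul c⟩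

/-- The Hilbert space of the induced representation `Ind_H^G χ`. -/
def IndSpace (χ : H →ₜ* Circle) : Type _ := indSubmodule χ

instance (χ : H →ₜ* Circle) : AddCommGroup (IndSpace χ) :=
  inferInstanceAs (AddCommGroup (indSubmodule χ))

instance (χ : H →ₜ* Circle) : Module ℂ (IndSpace χ) :=
  inferInstanceAs (Module ℂ (indSubmodule χ))

instance (χ : H →ₜ* Circle) : FunLike (IndSpace χ) G ℂ where
  coe ξ := (ξ : indSubmodule χ).1
  coe_injective _ _ h := Subtype.ext h

theorem IndSpace.apply_mul {χ : H →ₜ* Circle} (ξ : IndSpace χ) (y : G) (h : H) :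
    ξ (y * h) = ((χ h)⁻¹ : Circle) * ξ y :=
  (ξ : indSubmodule χ).2.1 y h

theorem IndSpace.memℓp {χ : H →ₜ* Circle} (ξ : IndSpace χ) :
    Memℓp (fun x : G ⧸ (H : Subgroup G) => ξ x.out) 2 :=
  (ξ : indSubmodule χ).2.2

/-- Restriction of `ξ` to a set of representatives of the left cosets of `H`. -/
def IndSpace.toL2 (χ : H →ₜ* Circle) :
    IndSpace χ →ₗ[ℂ] lp (fun _ : G ⧸ (H : Subgroup G) => ℂ) 2 where
  toFun ξ := ⟨fun x => ξ x.out, ξ.memℓp⟩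
  map_add' _ _ := rfl
  map_smul' _ _ := rfl

theorem IndSpace.toL2_apply (χ : H →ₜ* Circle) (ξ : IndSpace χ) (x : G ⧸ (H : Subgroup G)) :
    IndSpace.toL2 χ ξ x = ξ x.out := rfl

/-- Every element of `G` is the representative of its coset times an element of `H`. -/
theorem out_inv_mul_mem (y : G) : (Quotient.out (y : G ⧸ (H : Subgroup G)))⁻¹ * y ∈ H :=
  QuotientGroup.eq.1 (QuotientGroup.out_eq' (y : G ⧸ (H : Subgroup G)))

theorem IndSpace.apply_eq {χ : H →ₜ* Circle} (ξ : IndSpace χ) (y : G) :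
    ξ y = ((χ ⟨_, out_inv_mul_mem y⟩)⁻¹ : Circle) *
      ξ (Quotient.out (y : G ⧸ (H : Subgroup G))) := by
  rw [← ξ.apply_mul]
  simp

theorem IndSpace.norm_apply_eq {χ : H →ₜ* Circle} (ξ : IndSpace χ) (y : G) :
    ‖ξ y‖ = ‖ξ (Quotient.out (y : G ⧸ (H : Subgroup G)))‖ := by
  rw [ξ.apply_eq y, norm_mul, Circle.norm_coe, one_mul]

theorem IndSpace.toL2_injective (χ : H →ₜ* Circle) : Function.Injective (IndSpace.toL2 χ) := by
  intro ξ η h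
  refine DFunLike.ext _ _ fun y => ?_
  rw [ξ.apply_eq y, η.apply_eq y, ← IndSpace.toL2_apply, ← IndSpace.toL2_apply, h]

theorem IndSpace.toL2_surjective (χ : H →ₜ* Circle) : Function.Surjective (IndSpace.toL2 χ) := by
  intro f
  let F : G → ℂ := fun y =>
    (((χ ⟨_, out_inv_mul_mem y⟩)⁻¹ : Circle) : ℂ) * f (y : G ⧸ (H : Subgroup G))
  have key : ∀ x : G ⧸ (H : Subgroup G), F x.out = f x := fun x => by
    have h1 : ((x.out : G) : G ⧸ (H : Subgroup G)) = x := QuotientGroup.out_eq' x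
    have h2 : (⟨_, out_inv_mul_mem x.out⟩ : H) = 1 := Subtype.ext (by simp [h1])
    simp only [F]
    rw [h2, h1]
    simp
  have hF : ∀ (y : G) (h : H), F (y * h) = ((χ h)⁻¹ : Circle) * F y := fun y h => by
    have h1 : ((y * h : G) : G ⧸ (H : Subgroup G)) = y := QuotientGroup.mk_mul_of_mem y h.2
    have h2 : (⟨_, out_inv_mul_mem (y * h)⟩ : H) = ⟨_, out_inv_mul_mem y⟩ * h :=
      Subtype.ext (by simp [h1, mul_assoc])
    simp only [F]
    rw [h2, h1, map_mul, mul_inv_rev, Circle.coe_mul, mul_assoc]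
  have hm : Memℓp (fun x : G ⧸ (H : Subgroup G) => F x.out) 2 := by
    rw [funext key]
    exact lp.memℓp f
  exact ⟨(⟨F, hF, hm⟩ : indSubmodule χ), lp.ext (funext key)⟩

/-- The Hilbert space structure of `IndSpace χ`: the inner product of `ξ` and `η` is
`∑ conj (ξ x) * η x` over (representatives of) the left cosets `x ∈ G ⧸ H`. -/
instance (χ : H →ₜ* Circle) : NormedAddCommGroup (IndSpace χ) :=
  NormedAddCommGroup.induced (IndSpace χ) (lp (fun _ : G ⧸ (H : Subgroup G) => ℂ) 2)
    (IndSpace.toL2 χ) (IndSpace.toL2_injective χ)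

instance (χ : H →ₜ* Circle) : InnerProductSpace ℂ (IndSpace χ) :=
  InnerProductSpace.induced (IndSpace.toL2 χ)

/-- `IndSpace χ` is isometric to `ℓ²(G ⧸ H)`. -/
def IndSpace.equivL2 (χ : H →ₜ* Circle) :
    IndSpace χ ≃ₗᵢ[ℂ] lp (fun _ : G ⧸ (H : Subgroup G) => ℂ) 2 where
  toLinearEquiv := LinearEquiv.ofBijective (IndSpace.toL2 χ)
    ⟨IndSpace.toL2_injective χ, IndSpace.toL2_surjective χ⟩
  norm_map' _ := rfl

instance (χ : H →ₜ* Circle) : CompleteSpace (IndSpace χ) :=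
  (IndSpace.equivL2 χ).toIsometryEquiv.completeSpace

theorem IndSpace.norm_apply_mul_out {χ : H →ₜ* Circle} (ξ : IndSpace χ) (g : G)
    (x : G ⧸ (H : Subgroup G)) : ‖ξ (g * x.out)‖ = ‖ξ (g • x).out‖ := by
  have h : ((g * x.out : G) : G ⧸ (H : Subgroup G)) = g • x :=
    congrArg (g • ·) (QuotientGroup.out_eq' x)
  rw [ξ.norm_apply_eq (g * x.out), h]

/-- Left translation of an element of `IndSpace χ`: the function `y ↦ ξ (g⁻¹ y)`. -/
def IndSpace.translate {χ : H →ₜ* Circle} (g : G) (ξ : IndSpace χ) : IndSpace χ :=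
  have h1 : ∀ (y : G) (h : H), ξ (g⁻¹ * (y * h)) = ((χ h)⁻¹ : Circle) * ξ (g⁻¹ * y) :=
    fun y h => by rw [← mul_assoc, ξ.apply_mul]
  have h2 : Memℓp (fun x : G ⧸ (H : Subgroup G) => ξ (g⁻¹ * x.out)) 2 := by
    refine Memℓp.of_norm ?_
    simp only [ξ.norm_apply_mul_out]
    have h := ξ.memℓp.norm
    rw [memℓp_gen_iff (by norm_num)] at h ⊢
    exact h.comp_injective (MulAction.injective g⁻¹)
  (⟨fun y => ξ (g⁻¹ * y), h1, h2⟩ : indSubmodule χ)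

theorem IndSpace.translate_apply {χ : H →ₜ* Circle} (g : G) (ξ : IndSpace χ) (y : G) :
    ξ.translate g y = ξ (g⁻¹ * y) := rfl

theorem IndSpace.norm_translate {χ : H →ₜ* Circle} (g : G) (ξ : IndSpace χ) :
    ‖ξ.translate g‖ = ‖ξ‖ := by
  change ‖IndSpace.toL2 χ (ξ.translate g)‖ = ‖IndSpace.toL2 χ ξ‖
  rw [lp.norm_eq_tsum_rpow (by norm_num), lp.norm_eq_tsum_rpow (by norm_num)]
  congr 1
  refine (tsum_congr fun x => ?_).trans
    ((MulAction.toPerm g⁻¹ : Equiv.Perm (G ⧸ (H : Subgroup G))).tsum_eq _)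
  exact congrArg (· ^ _) (ξ.norm_apply_mul_out g⁻¹ x)

/-- The group `G` acts on `IndSpace χ` by left translations. -/
def indHom (χ : H →ₜ* Circle) : G →* (IndSpace χ ≃ₗᵢ[ℂ] IndSpace χ) where
  toFun g :=
    { toFun := IndSpace.translate g
      invFun := IndSpace.translate g⁻¹
      map_add' := fun _ _ => rfl
      map_smul' := fun _ _ => rfl
      left_inv := fun ξ => DFunLike.ext _ _ fun y => by simp [IndSpace.translate_apply]
      right_inv := fun ξ => DFunLike.ext _ _ fun y => by simp [IndSpace.translate_apply]
      norm_map' := IndSpace.norm_translate g }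
  map_one' := LinearIsometryEquiv.ext fun ξ => DFunLike.ext _ _ fun y =>
    congrArg ξ (by simp)
  map_mul' a b := LinearIsometryEquiv.ext fun ξ => DFunLike.ext _ _ fun y =>
    congrArg ξ (by simp [mul_assoc])

theorem indHom_apply (χ : H →ₜ* Circle) (g : G) (ξ : IndSpace χ) (y : G) :
    indHom χ g ξ y = ξ (g⁻¹ * y) := rfl

theorem continuous_indHom [IsTopologicalGroup G] (χ : H →ₜ* Circle) (ξ : IndSpace χ) :
    Continuous fun g : G => indHom χ g ξ := by
  -- It suffices to check continuity at the identity.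
  suffices hone : ∀ ξ : IndSpace χ, Tendsto (fun g : G => indHom χ g ξ) (𝓝 1) (𝓝 ξ) by
    refine continuous_iff_continuousAt.2 fun a => ?_
    have h1 : Tendsto (fun g : G => a⁻¹ * g) (𝓝 a) (𝓝 1) := by
      have : Continuous fun g : G => a⁻¹ * g := by fun_prop
      simpa using this.tendsto a
    have h2 := ((indHom χ a).continuous.tendsto ξ).comp ((hone ξ).comp h1)
    refine h2.congr fun g => ?_
    change (indHom χ a * indHom χ (a⁻¹ * g)) ξ = _
    rw [← map_mul, mul_inv_cancel_left]
  -- The vectors for which this holds form a closed subspace.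
  have hcl : IsClosed {ξ : IndSpace χ | Tendsto (fun g : G => indHom χ g ξ) (𝓝 1) (𝓝 ξ)} := by
    refine isClosed_of_closure_subset fun ξ hξ => Metric.tendsto_nhds.2 fun ε hε => ?_
    obtain ⟨η, hη, hd⟩ := Metric.mem_closure_iff.1 hξ (ε / 3) (by positivity)
    filter_upwards [Metric.tendsto_nhds.1 hη (ε / 3) (by positivity)] with g hg
    have h1 : dist (indHom χ g ξ) (indHom χ g η) = dist ξ η := (indHom χ g).dist_map _ _
    have h2 := dist_triangle4 (indHom χ g ξ) (indHom χ g η) η ξ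
    rw [h1, dist_comm η ξ] at h2
    linarith
  -- It contains the functions supported on one coset.
  have hsingle : ∀ (x : G ⧸ (H : Subgroup G)) (ξ : IndSpace χ),
      (∀ y : G, (y : G ⧸ (H : Subgroup G)) ≠ x → ξ y = 0) →
      Tendsto (fun g : G => indHom χ g ξ) (𝓝 1) (𝓝 ξ) := by
    intro x ξ hξ
    obtain ⟨s, rfl⟩ := QuotientGroup.mk_surjective x
    have h1 : Tendsto (fun k : H => (((χ k)⁻¹ : Circle) : ℂ) • ξ) (𝓝 1) (𝓝 ξ) := by
      have hc : Continuous fun k : H => (((χ k)⁻¹ : Circle) : ℂ) • ξ := by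
        have := χ.continuous_toFun
        have h' : Continuous fun k : H => (((χ k)⁻¹ : Circle) : ℂ) :=
          continuous_subtype_val.comp this.inv
        exact h'.smul continuous_const
      simpa using hc.tendsto 1
    have h2 : Tendsto (fun g : G => s⁻¹ * g⁻¹ * s) (𝓝 1) (𝓝 1) := by
      have : Continuous fun g : G => s⁻¹ * g⁻¹ * s := by fun_prop
      simpa using this.tendsto 1
    refine Metric.tendsto_nhds.2 fun ε hε => ?_
    have h3 : ∀ᶠ g' in 𝓝 (1 : G), ∃ k : H, (k : G) = g' ∧
        dist ((((χ k)⁻¹ : Circle) : ℂ) • ξ) ξ < ε := by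
      have h4 := H.isOpen.isOpenEmbedding_subtypeVal.map_nhds_eq (1 : H)
      change map _ _ = 𝓝 (1 : G) at h4
      rw [← h4, eventually_map]
      filter_upwards [Metric.tendsto_nhds.1 h1 ε hε] with k hk
      exact ⟨k, rfl, hk⟩
    filter_upwards [h2.eventually h3] with g hg
    obtain ⟨k, hk, hd⟩ := hg
    convert hd using 2
    refine DFunLike.ext _ _ fun y => ?_
    change ξ (g⁻¹ * y) = (((χ k)⁻¹ : Circle) : ℂ) * ξ y
    by_cases hy : (s : G ⧸ (H : Subgroup G)) = y
    · obtain ⟨h, rfl⟩ : ∃ h : H, s * h = y := ⟨⟨s⁻¹ * y, QuotientGroup.eq.1 hy⟩, by simp⟩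
      have h5 : g⁻¹ * (s * h) = s * k * h := by rw [hk]; group
      rw [h5, ξ.apply_mul, ξ.apply_mul, ξ.apply_mul]
      ring
    · rw [hξ y (Ne.symm hy), mul_zero]
      refine hξ _ fun h => hy ?_
      refine QuotientGroup.eq.2 ?_
      have h6 := QuotientGroup.eq.1 h.symm
      have h7 : s⁻¹ * y = (k : G)⁻¹ * (s⁻¹ * (g⁻¹ * y)) := by rw [hk]; group
      rw [h7]
      exact mul_mem (inv_mem k.2) h6
  -- Every vector is a limit of finite sums of such functions.
  intro ξ
  classical
  have hsum := lp.hasSum_single (p := 2) (by norm_num) (IndSpace.equivL2 χ ξ)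
  have hlim := ((IndSpace.equivL2 χ).symm.continuous.tendsto _).comp hsum
  rw [LinearIsometryEquiv.symm_apply_apply] at hlim
  refine hcl.mem_of_tendsto hlim (Eventually.of_forall fun t => ?_)
  change Tendsto (fun g : G => indHom χ g ((IndSpace.equivL2 χ).symm _)) (𝓝 1)
    (𝓝 ((IndSpace.equivL2 χ).symm _))
  simp only [map_sum]
  refine tendsto_finsetSum _ fun x _ => hsingle x _ fun y hy => norm_eq_zero.1 ?_
  rw [IndSpace.norm_apply_eq, ← IndSpace.toL2_apply]
  change ‖IndSpace.equivL2 χ ((IndSpace.equivL2 χ).symm _) _‖ = 0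
  rw [LinearIsometryEquiv.apply_symm_apply, lp.single_apply_ne _ _ _ hy, norm_zero]

/-- The monomial representation `Ind_H^G χ` associated to the open subgroup `H` of `G` and the
unitary character `χ` of `H`. -/
def monomialRep [IsTopologicalGroup G] (χ : H →ₜ* Circle) : IsomRep G (IndSpace χ) where
  toHom := indHom χ
  continuous_apply := continuous_indHom χ

end Monomial

/-- Property `(T; R_mon)`, where `R_mon` is the family of all monomial representations
`Ind_H^G χ` with `H` an open subgroup of `G` and `χ` a unitary character of `H`. -/
def PropertyTRmon (G : Type*) [Group G] [TopologicalSpace G] [IsTopologicalGroup G] : Prop :=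
  PropertyTR G fun i : (Σ H : OpenSubgroup G, H →ₜ* Circle) => monomialRep i.2

end GroupRep

end

noncomputable section

namespace GroupRep

/-! ### The Mazur map -/

/-! For `p ≠ 2` the isometries of `ℓ_p` are rigid: by Banach–Lamperti (`exists_map_single`) they
permute the canonical basis up to phases. So a representation on `ℓ_p(X)` is an action of `G` on `X`
together with a circle-valued cocycle (`exists_eq_rep`), and these data make sense at every
exponent.

The Mazur map commutes with permutations and phases and is uniformly continuous on unit spheres. It
therefore carries almost invariant vectors from one exponent to another. It does not preserve the
complement of the invariant vectors, but the image of a unit vector of the complement stays at a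
definite distance from the invariant vectors; subtracting an approximate invariant part and
normalising brings it back into the complement (`hasAlmostInvariantVectorsIn_rep`). Thus everything
can be tested at exponent `2`.

On `ℓ_2(X)` the orbits split the representation into monomial representations induced from
stabilizers, which are open by continuity. Almost invariant vectors in a Hilbert sum yield almost
invariant vectors in single summands, by averaging over a compact neighbourhood of the identity
(`exists_almost_invariant_summand`). So failure of either property leads to the condition
`HasAlmostInvariantMonomialReps`, in which no exponent occurs.

Conversely, from this condition one picks a monomial representation for each set of a compact
exhaustion. The cosets of an open subgroup are countable, so the disjoint union of the chosen coset
spaces is a copy of `ℕ`, and its cocycle representation at exponent `2`, transferred to `p`,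
contradicts Property `(T_{ℓ_p})`. -/

/-- The map of the complex plane which keeps arguments and raises moduli to the
power `t`. -/
def powModulus (t : ℝ) (z : ℂ) : ℂ := z * ((‖z‖ ^ (t - 1) : ℝ) : ℂ)

theorem norm_powModulus {t : ℝ} (ht : 0 < t) (z : ℂ) : ‖powModulus t z‖ = ‖z‖ ^ t := by
  rcases eq_or_ne z 0 with rfl | hz
  · simp [powModulus, Real.zero_rpow ht.ne']
  · have hz' : 0 < ‖z‖ := norm_pos_iff.2 hz
    rw [powModulus, norm_mul, Complex.norm_real, Real.norm_of_nonneg (by positivity),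
      Real.rpow_sub_one hz'.ne', mul_div_cancel₀ _ hz'.ne']

theorem powModulus_real_smul {t : ℝ} {r : ℝ} (hr : 0 < r) (z : ℂ) :
    powModulus t (r * z) = ((r ^ t : ℝ) : ℂ) * powModulus t z := by
  simp only [powModulus, norm_mul, Complex.norm_real, Real.norm_of_nonneg hr.le]
  rw [Real.mul_rpow hr.le (norm_nonneg z), Real.rpow_sub_one hr.ne']
  have : (r : ℂ) ≠ 0 := by exact_mod_cast hr.ne'
  push_cast
  field_simp

theorem powModulus_circle_mul (t : ℝ) (c : Circle) (z : ℂ) :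
    powModulus t (c * z) = c * powModulus t z := by
  simp only [powModulus, norm_mul, Circle.norm_coe, one_mul, mul_assoc]

theorem powModulus_powModulus {s t : ℝ} (ht : 0 < t) (hst : t * s = 1) (z : ℂ) :
    powModulus s (powModulus t z) = z := by
  rcases eq_or_ne z 0 with rfl | hz
  · simp [powModulus]
  · have hz' : 0 < ‖z‖ := norm_pos_iff.2 hz
    rw [powModulus, norm_powModulus ht, powModulus, mul_assoc, ← Complex.ofReal_mul,
      ← Real.rpow_mul hz'.le, ← Real.rpow_add hz',
      show t - 1 + t * (s - 1) = 0 by rw [mul_sub, hst]; ring]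
    simp

/-- The real factor can be unbounded near `0` when `t < 1`, so the origin is treated through the
modulus, which tends to `0`; elsewhere the defining formula is visibly continuous. -/
theorem continuous_powModulus {t : ℝ} (ht : 0 < t) : Continuous (powModulus t) := by
  refine continuous_iff_continuousAt.2 fun z => ?_
  rcases eq_or_ne z 0 with rfl | hz
  · have h0 : powModulus t 0 = 0 := by simp [powModulus]
    rw [ContinuousAt, h0, tendsto_zero_iff_norm_tendsto_zero]
    simp only [norm_powModulus ht]
    have h : Continuous fun z : ℂ => ‖z‖ ^ t :=
      continuous_norm.rpow_const fun _ => Or.inr ht.le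
    simpa [Real.zero_rpow ht.ne'] using h.tendsto 0
  · unfold powModulus
    refine continuousAt_id.mul (Complex.continuous_ofReal.continuousAt.comp ?_)
    exact continuous_norm.continuousAt.rpow_const (Or.inl (norm_ne_zero_iff.2 hz))

/-- A quantitative form of the uniform continuity on bounded sets of `powModulus`, which can be
summed over coordinates. -/
theorem exists_norm_powModulus_sub_rpow_le {t r s : ℝ} (ht : 0 < t) (hs : 0 < s)
    (hts : t * s = r) {η : ℝ} (hη : 0 < η) :
    ∃ C : ℝ, 0 ≤ C ∧ ∀ a b : ℂ, ‖powModulus t a - powModulus t b‖ ^ s ≤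
      η * (‖a‖ ^ r + ‖b‖ ^ r) + C * ‖a - b‖ ^ r := by
  have hr : 0 < r := hts ▸ mul_pos ht hs
  have huc : UniformContinuousOn (powModulus t) (Metric.closedBall 0 1) :=
    (isCompact_closedBall 0 1).uniformContinuousOn_of_continuous
      (continuous_powModulus ht).continuousOn
  obtain ⟨δ, hδ, hd⟩ := Metric.uniformContinuousOn_iff.1 huc (η ^ s⁻¹) (by positivity)
  -- On the unit disc, nearby points are handled by uniform continuity; for points at distance at
  -- least `δ` the left side is at most `2 ^ s`, which the last term dominates.
  have key : ∀ a b : ℂ, ‖a‖ ≤ 1 → ‖b‖ ≤ 1 →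
      ‖powModulus t a - powModulus t b‖ ^ s ≤ η + 2 ^ s / δ ^ r * ‖a - b‖ ^ r := by
    intro a b ha hb
    rcases lt_or_ge (dist a b) δ with h | h
    · have h1 := (hd a (by simpa using ha) b (by simpa using hb) h).le
      rw [dist_eq_norm] at h1
      have h2 : ‖powModulus t a - powModulus t b‖ ^ s ≤ (η ^ s⁻¹) ^ s := by gcongr
      rw [Real.rpow_inv_rpow hη.le hs.ne'] at h2
      have : 0 ≤ 2 ^ s / δ ^ r * ‖a - b‖ ^ r := by positivity
      linarith
    · have h1 : ‖powModulus t a - powModulus t b‖ ≤ 2 := by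
        refine (norm_sub_le _ _).trans ?_
        rw [norm_powModulus ht, norm_powModulus ht]
        have := Real.rpow_le_one (norm_nonneg a) ha ht.le
        have := Real.rpow_le_one (norm_nonneg b) hb ht.le
        linarith
      have h2 : ‖powModulus t a - powModulus t b‖ ^ s ≤ 2 ^ s := by gcongr
      have h3 : δ ^ r ≤ ‖a - b‖ ^ r := by rw [← dist_eq_norm]; gcongr
      have h4 : (2 : ℝ) ^ s ≤ 2 ^ s / δ ^ r * ‖a - b‖ ^ r := by
        rw [div_mul_eq_mul_div, le_div_iff₀ (by positivity)]
        gcongr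
      linarith
  refine ⟨2 ^ s / δ ^ r, by positivity, fun a b => ?_⟩
  -- Since `t * s = r`, both sides are homogeneous of degree `r`; dividing by the larger modulus
  -- reduces to the unit disc.
  obtain ⟨L, hL⟩ : ∃ L, L = max ‖a‖ ‖b‖ := ⟨_, rfl⟩
  have hLa : ‖a‖ ≤ L := hL ▸ le_max_left _ _
  have hLb : ‖b‖ ≤ L := hL ▸ le_max_right _ _
  rcases ((norm_nonneg a).trans hLa).eq_or_lt with h0 | h0
  · have ha : a = 0 := norm_le_zero_iff.1 (h0 ▸ hLa)
    have hb : b = 0 := norm_le_zero_iff.1 (h0 ▸ hLb)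
    simp [ha, hb, powModulus, Real.zero_rpow hs.ne', Real.zero_rpow hr.ne']
  · have hL0 : (L : ℂ) ≠ 0 := by exact_mod_cast h0.ne'
    obtain ⟨a', rfl⟩ : ∃ a', (L : ℂ) * a' = a := ⟨a / L, mul_div_cancel₀ _ hL0⟩
    obtain ⟨b', rfl⟩ : ∃ b', (L : ℂ) * b' = b := ⟨b / L, mul_div_cancel₀ _ hL0⟩
    have hn : ∀ z : ℂ, ‖(L : ℂ) * z‖ = L * ‖z‖ := fun z => by
      rw [norm_mul, Complex.norm_real, Real.norm_of_nonneg h0.le]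
    have ha1 : ‖a'‖ ≤ 1 := by
      rw [hn] at hLa
      exact le_of_mul_le_mul_left (by linarith) h0
    have hb1 : ‖b'‖ ≤ 1 := by
      rw [hn] at hLb
      exact le_of_mul_le_mul_left (by linarith) h0
    have hLr : L ^ r ≤ ‖(L : ℂ) * a'‖ ^ r + ‖(L : ℂ) * b'‖ ^ r := by
      rcases max_choice ‖(L : ℂ) * a'‖ ‖(L : ℂ) * b'‖ with h | h
      · rw [show L ^ r = _ from congrArg (· ^ r) (hL.trans h)]
        have : 0 ≤ ‖(L : ℂ) * b'‖ ^ r := by positivity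
        linarith
      · rw [show L ^ r = _ from congrArg (· ^ r) (hL.trans h)]
        have : 0 ≤ ‖(L : ℂ) * a'‖ ^ r := by positivity
        linarith
    have hk := key a' b' ha1 hb1
    rw [powModulus_real_smul h0, powModulus_real_smul h0, ← mul_sub, norm_mul, Complex.norm_real,
      Real.norm_of_nonneg (by positivity), Real.mul_rpow (by positivity) (by positivity),
      ← Real.rpow_mul h0.le, hts, ← mul_sub, hn (a' - b'),
      Real.mul_rpow h0.le (norm_nonneg _)]
    calc L ^ r * ‖powModulus t a' - powModulus t b'‖ ^ s
        ≤ L ^ r * (η + 2 ^ s / δ ^ r * ‖a' - b'‖ ^ r) := by gcongr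
      _ = η * L ^ r + 2 ^ s / δ ^ r * (L ^ r * ‖a' - b'‖ ^ r) := by ring
      _ ≤ _ := by gcongr

variable {X : Type*}

theorem norm_powModulus_rpow_toReal {p q : ℝ≥0∞} (hp : 0 < p.toReal) (hq : 0 < q.toReal) (z : ℂ) :
    ‖powModulus (p.toReal / q.toReal) z‖ ^ q.toReal = ‖z‖ ^ p.toReal := by
  rw [norm_powModulus (div_pos hp hq), ← Real.rpow_mul (norm_nonneg _), div_mul_cancel₀ _ hq.ne']

theorem memℓp_powModulus {p q : ℝ≥0∞} (hp : 0 < p.toReal) (hq : 0 < q.toReal)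
    (f : lp (fun _ : X => ℂ) p) : Memℓp (fun x => powModulus (p.toReal / q.toReal) (f x)) q := by
  rw [memℓp_gen_iff hq]
  simp only [norm_powModulus_rpow_toReal hp hq]
  exact (lp.memℓp f).summable hp

/-- The Mazur map `f ↦ f |f| ^ (p / q - 1)` from `ℓ_p` to `ℓ_q`. -/
def mazur {p : ℝ≥0∞} (q : ℝ≥0∞) (hp : 0 < p.toReal) (hq : 0 < q.toReal)
    (f : lp (fun _ : X => ℂ) p) : lp (fun _ : X => ℂ) q :=
  ⟨fun x => powModulus (p.toReal / q.toReal) (f x), memℓp_powModulus hp hq f⟩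

variable {p q : ℝ≥0∞} (hp : 0 < p.toReal) (hq : 0 < q.toReal)

theorem mazur_apply (f : lp (fun _ : X => ℂ) p) (x : X) :
    mazur q hp hq f x = powModulus (p.toReal / q.toReal) (f x) := rfl

theorem mazur_mazur (f : lp (fun _ : X => ℂ) p) : mazur p hq hp (mazur q hp hq f) = f :=
  lp.ext <| funext fun x => powModulus_powModulus (div_pos hp hq) (by field_simp) (f x)

theorem norm_mazur_rpow (f : lp (fun _ : X => ℂ) p) :
    ‖mazur q hp hq f‖ ^ q.toReal = ‖f‖ ^ p.toReal := by
  rw [lp.norm_rpow_eq_tsum hq, lp.norm_rpow_eq_tsum hp]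
  exact tsum_congr fun x => norm_powModulus_rpow_toReal hp hq (f x)

theorem norm_mazur_eq_one {f : lp (fun _ : X => ℂ) p} (hf : ‖f‖ = 1) :
    ‖mazur q hp hq f‖ = 1 := by
  have h := norm_mazur_rpow hp hq f
  rw [hf, Real.one_rpow] at h
  exact (Real.rpow_left_inj (lp.norm_nonneg' _) zero_le_one hq.ne').1 (h.trans (Real.one_rpow _).symm)

/-- The Mazur map is uniformly continuous on the unit sphere. -/
theorem exists_norm_mazur_sub_lt {ε : ℝ} (hε : 0 < ε) :
    ∃ δ > 0, ∀ f g : lp (fun _ : X => ℂ) p, ‖f‖ = 1 → ‖g‖ = 1 → ‖f - g‖ < δ →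
      ‖mazur q hp hq f - mazur q hp hq g‖ < ε := by
  obtain ⟨r, hr⟩ : ∃ r, r = p.toReal := ⟨_, rfl⟩
  obtain ⟨s, hs⟩ : ∃ s, s = q.toReal := ⟨_, rfl⟩
  have hp' : 0 < r := hr ▸ hp
  have hq' : 0 < s := hs ▸ hq
  obtain ⟨C, hC, hle⟩ := exists_norm_powModulus_sub_rpow_le (div_pos hp' hq') hq'
    (div_mul_cancel₀ r hq'.ne') (show 0 < ε ^ s / 4 by positivity)
  have hC1 : 0 < C + 1 := by linarith
  -- The two unit vectors contribute `2 * (ε ^ s / 4)` and this radius makes the `C` term at most `ε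
  -- ^ s / 4`, for a total below `ε ^ s`. Using `C + 1` avoids dividing by zero.
  refine ⟨(ε ^ s / (4 * (C + 1))) ^ r⁻¹, by positivity, fun f g hf hg hfg => ?_⟩
  have hsf := lp.hasSum_norm hp f
  have hsg := lp.hasSum_norm hp g
  have hsd := lp.hasSum_norm hp (f - g)
  have hsm := lp.hasSum_norm hq (mazur q hp hq f - mazur q hp hq g)
  rw [← hr] at hsf hsg hsd
  rw [← hs] at hsm
  have h1 := hasSum_le (fun x => ?_) hsm (((hsf.add hsg).mul_left (ε ^ s / 4)).add (hsd.mul_left C))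
  swap
  · rw [lp.coeFn_sub, lp.coeFn_sub, Pi.sub_apply, Pi.sub_apply, mazur_apply, mazur_apply, ← hr,
      ← hs]
    exact hle (f x) (g x)
  rw [hf, hg, Real.one_rpow] at h1
  have h2 : ‖f - g‖ ^ r ≤ ε ^ s / (4 * (C + 1)) := by
    have : ‖f - g‖ ^ r ≤ ((ε ^ s / (4 * (C + 1))) ^ r⁻¹) ^ r := by
      have := lp.norm_nonneg' (f - g)
      gcongr
    rwa [Real.rpow_inv_rpow (by positivity) hp'.ne'] at this
  have h3 : C * ‖f - g‖ ^ r ≤ ε ^ s / 4 := by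
    calc C * ‖f - g‖ ^ r ≤ (C + 1) * (ε ^ s / (4 * (C + 1))) := by
          have := Real.rpow_nonneg (lp.norm_nonneg' (f - g)) r
          gcongr
          linarith
      _ = ε ^ s / 4 := by field_simp
  have h4 : 0 < ε ^ s := by positivity
  refine (Real.rpow_lt_rpow_iff (lp.norm_nonneg' _) hε.le hq').1 (h1.trans_lt ?_)
  linarith

/-! ### Group actions with phases and their representations on `ℓ_p` -/

/-- A cocycle with values in the circle for an action of `G` on a set `X`. -/
structure PhaseCocycle (G X : Type*) [Group G] [MulAction G X] where
  toFun : G → X → Circle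
  map_mul' : ∀ g h x, toFun (g * h) x = toFun g x * toFun h (g⁻¹ • x)

namespace PhaseCocycle

variable {G X : Type*} [Group G] [MulAction G X]

instance : CoeFun (PhaseCocycle G X) fun _ => G → X → Circle := ⟨toFun⟩

variable (c : PhaseCocycle G X)

theorem map_mul (g h : G) (x : X) : c (g * h) x = c g x * c h (g⁻¹ • x) := c.map_mul' g h x

@[simp]
theorem map_one (x : X) : c 1 x = 1 := by
  have h := c.map_mul 1 1 x
  rw [mul_one, inv_one, one_smul] at h
  exact left_eq_mul.1 h

theorem map_inv_mul (g : G) (x : X) : c g⁻¹ (g⁻¹ • x) * c g x = 1 := by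
  have h := c.map_mul g⁻¹ g (g⁻¹ • x)
  rw [inv_mul_cancel, map_one, inv_inv, smul_inv_smul] at h
  exact h.symm

variable {p q : ℝ≥0∞}

theorem memℓp_twist (hp : 0 < p.toReal) (g : G) (f : lp (fun _ : X => ℂ) p) :
    Memℓp (fun x => (c g x : ℂ) * f (g⁻¹ • x)) p := by
  rw [memℓp_gen_iff hp]
  simp only [norm_mul, Circle.norm_coe, one_mul]
  exact ((MulAction.toPerm g⁻¹ : Equiv.Perm X).summable_iff
    (f := fun x => ‖f x‖ ^ p.toReal)).2 ((lp.memℓp f).summable hp)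

/-- The action of an element of the group on `ℓ_p`, `(g f) x = c(g, x) f(g⁻¹ x)`. -/
def twist (hp : 0 < p.toReal) (g : G) (f : lp (fun _ : X => ℂ) p) : lp (fun _ : X => ℂ) p :=
  ⟨fun x => (c g x : ℂ) * f (g⁻¹ • x), c.memℓp_twist hp g f⟩

theorem twist_apply (hp : 0 < p.toReal) (g : G) (f : lp (fun _ : X => ℂ) p) (x : X) :
    c.twist hp g f x = c g x * f (g⁻¹ • x) := rfl

theorem twist_mul (hp : 0 < p.toReal) (g h : G) (f : lp (fun _ : X => ℂ) p) :
    c.twist hp (g * h) f = c.twist hp g (c.twist hp h f) :=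
  lp.ext <| funext fun x => by
    simp only [twist_apply]
    rw [map_mul, mul_inv_rev, mul_smul, Circle.coe_mul, mul_assoc]

theorem twist_one (hp : 0 < p.toReal) (f : lp (fun _ : X => ℂ) p) : c.twist hp 1 f = f :=
  lp.ext <| funext fun x => by simp [twist_apply]

theorem norm_twist (hp : 0 < p.toReal) (g : G) (f : lp (fun _ : X => ℂ) p) :
    ‖c.twist hp g f‖ = ‖f‖ := by
  rw [lp.norm_eq_tsum_rpow hp, lp.norm_eq_tsum_rpow hp]
  congr 1
  simp only [twist_apply, norm_mul, Circle.norm_coe, one_mul]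
  exact (MulAction.toPerm g⁻¹ : Equiv.Perm X).tsum_eq fun x => ‖f x‖ ^ p.toReal

variable [Fact (1 ≤ p)] [Fact (1 ≤ q)]

/-- The representation on `ℓ_p(X)` associated to a cocycle for an action on `X`. -/
def rep (hp : 0 < p.toReal) : G →* (lp (fun _ : X => ℂ) p ≃ₗᵢ[ℂ] lp (fun _ : X => ℂ) p) where
  toFun g :=
    { toFun := c.twist hp g
      invFun := c.twist hp g⁻¹
      map_add' := fun a b => lp.ext <| funext fun x => mul_add _ _ _
      map_smul' := fun r a => lp.ext <| funext fun x => mul_left_comm _ _ _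
      left_inv := fun f => by rw [← twist_mul, inv_mul_cancel, twist_one]
      right_inv := fun f => by rw [← twist_mul, mul_inv_cancel, twist_one]
      norm_map' := c.norm_twist hp g }
  map_one' := LinearIsometryEquiv.ext fun f => c.twist_one hp f
  map_mul' a b := LinearIsometryEquiv.ext fun f => c.twist_mul hp a b f

theorem rep_apply (hp : 0 < p.toReal) (g : G) (f : lp (fun _ : X => ℂ) p) (x : X) :
    c.rep hp g f x = c g x * f (g⁻¹ • x) := rfl

theorem rep_single [DecidableEq X] (hp : 0 < p.toReal) (g : G) (x : X) (a : ℂ) :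
    c.rep hp g (lp.single p x a) = lp.single p (g • x) ((c g (g • x) : ℂ) * a) :=
  lp.ext <| funext fun y => by
    rw [rep_apply]
    rcases eq_or_ne y (g • x) with rfl | hy
    · rw [inv_smul_smul, lp.single_apply_self, lp.single_apply_self]
    · rw [lp.single_apply_ne _ _ _ hy, lp.single_apply_ne, mul_zero]
      rintro rfl
      exact hy (smul_inv_smul g y).symm

/-- A coordinatewise map does not see permutations of the coordinates, and `powModulus` commutes
with phases. This is what allows the exponent to change. -/
theorem mazur_rep (hp : 0 < p.toReal) (hq : 0 < q.toReal) (g : G) (f : lp (fun _ : X => ℂ) p) :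
    mazur q hp hq (c.rep hp g f) = c.rep hq g (mazur q hp hq f) :=
  lp.ext <| funext fun x => by
    simp only [rep_apply, mazur_apply, powModulus_circle_mul]

theorem mazur_mem_invariants (hp : 0 < p.toReal) (hq : 0 < q.toReal) {f : lp (fun _ : X => ℂ) p}
    (hf : f ∈ invariants (c.rep hp)) : mazur q hp hq f ∈ invariants (c.rep hq) := fun g => by
  rw [← mazur_rep, hf g]

end PhaseCocycle

/-! ### Duality -/

section Duality

variable {X : Type*} {p q : ℝ≥0∞} [Fact (1 ≤ p)] [Fact (1 ≤ q)]

theorem norm_mul_clm_le : ∀ _ : X, ‖ContinuousLinearMap.mul ℂ ℂ‖ ≤ ((1 : NNReal) : ℝ) :=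
  fun _ => ContinuousLinearMap.opNorm_mul_le ℂ ℂ

/-- The functional `f ↦ ∑ conj (b x) * f x` on `ℓ_p` for `b ∈ ℓ_q`. -/
def lpFunctional [q.HolderConjugate p] (b : lp (fun _ : X => ℂ) q) :
    StrongDual ℂ (lp (fun _ : X => ℂ) p) :=
  lp.dualPairing q p (fun _ : X => ContinuousLinearMap.mul ℂ ℂ) norm_mul_clm_le (star b)

variable [q.HolderConjugate p]

theorem lpFunctional_apply (b : lp (fun _ : X => ℂ) q) (f : lp (fun _ : X => ℂ) p) :
    lpFunctional b f = ∑' x, star (b x) * f x := rfl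

theorem norm_lpFunctional_apply_le (b : lp (fun _ : X => ℂ) q) (f : lp (fun _ : X => ℂ) p) :
    ‖lpFunctional b f‖ ≤ ‖b‖ * ‖f‖ := by
  refine (ContinuousLinearMap.le_opNorm₂ _ _ _).trans ?_
  rw [norm_star]
  have h := lp.norm_dualPairing (p := q) (q := p)
    (B := fun _ : X => ContinuousLinearMap.mul ℂ ℂ) norm_mul_clm_le
  rw [NNReal.coe_one] at h
  have := mul_le_mul_of_nonneg_right h (norm_nonneg b)
  rw [one_mul] at this
  exact mul_le_mul_of_nonneg_right this (norm_nonneg f)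

theorem lpFunctional_single [DecidableEq X] (b : lp (fun _ : X => ℂ) q) (x : X) (a : ℂ) :
    lpFunctional b (lp.single p x a) = star (b x) * a := by
  rw [lpFunctional_apply, tsum_eq_single x fun y hy => ?_, lp.single_apply_self]
  rw [lp.single_apply_ne _ _ _ hy, mul_zero]

/-- For conjugate exponents `p / q = p - 1`, so each coordinate of the pairing is `|w x| ^ p`. The
Mazur image of `w` is thus a norming functional, which plays the role of the inner product with `w`.
-/
theorem lpFunctional_mazur (h : p.toReal.HolderConjugate q.toReal) (w : lp (fun _ : X => ℂ) p) :
    lpFunctional (mazur q h.pos h.symm.pos w) w = ((‖w‖ ^ p.toReal : ℝ) : ℂ) := by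
  rw [lpFunctional_apply, lp.norm_rpow_eq_tsum h.pos, Complex.ofReal_tsum]
  refine tsum_congr fun x => ?_
  rw [mazur_apply, powModulus, h.div_conj_eq_sub_one]
  rcases eq_or_ne (w x) 0 with hx | hx
  · simp [hx, Real.zero_rpow h.pos.ne']
  · have hx' : 0 < ‖w x‖ := norm_pos_iff.2 hx
    have h1 : star (w x) * w x = ((‖w x‖ ^ 2 : ℝ) : ℂ) := by
      rw [mul_comm]
      exact_mod_cast Complex.mul_conj' (w x)
    rw [star_mul', Complex.star_def, Complex.conj_ofReal, mul_right_comm, ← Complex.star_def, h1,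
      ← Complex.ofReal_mul, ← Real.rpow_natCast, ← Real.rpow_add hx']
    congr 2
    push_cast
    ring

/-- Every functional on `ℓ_p` is given by an element of `ℓ_q`. -/
theorem exists_lpFunctional_eq (h : p.toReal.HolderConjugate q.toReal)
    (φ : StrongDual ℂ (lp (fun _ : X => ℂ) p)) :
    ∃ b : lp (fun _ : X => ℂ) q, lpFunctional b = φ := by
  classical
  have hp := h.pos
  have hq := h.symm.pos
  let b : X → ℂ := fun x => star (φ (lp.single p x 1))
  have hφ : ∀ x a, φ (lp.single p x a) = star (b x) * a := fun x a => by
    have : lp.single p x a = a • lp.single (E := fun _ : X => ℂ) p x 1 := by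
      rw [← lp.single_smul, smul_eq_mul, mul_one]
    rw [this, map_smul, smul_eq_mul, mul_comm]
    simp [b]
  have hb : Memℓp b q := by
    -- Testing `φ` on the finitely supported vector with coordinates `powModulus (q / p) (b x)`
    -- gives `N ≤ ‖φ‖ * N ^ (1 / p)`, hence `N ^ (1 / q) ≤ ‖φ‖`.
    refine memℓp_gen' (C := ‖φ‖ ^ q.toReal) fun s => ?_
    set N := ∑ x ∈ s, ‖b x‖ ^ q.toReal with hN
    have hN0 : 0 ≤ N := Finset.sum_nonneg fun x _ => by positivity
    rcases hN0.eq_or_lt with h0 | h0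
    · rw [← h0]; positivity
    -- The scalar identity is the pairing formula on a one-point set with the exponents exchanged,
    -- after conjugation.
    have hval : ∀ x, star (b x) * powModulus (q.toReal / p.toReal) (b x) =
        ((‖b x‖ ^ q.toReal : ℝ) : ℂ) := fun x => by
      have h1 := lpFunctional_mazur (X := Unit) (p := q) (q := p) h.symm
        ⟨fun _ => b x, Memℓp.all _⟩
      rw [lpFunctional_apply, lp.norm_rpow_eq_tsum hq] at h1
      simp only [tsum_fintype, Finset.univ_unique, Finset.sum_singleton, mazur_apply] at h1
      have h2 := congrArg star h1
      simp only [star_mul', star_star] at h2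
      rw [mul_comm, Complex.star_def, Complex.conj_ofReal] at h2
      exact h2
    let f : X → ℂ := fun x => powModulus (q.toReal / p.toReal) (b x)
    have h1 : φ (∑ x ∈ s, lp.single p x (f x)) = (N : ℂ) := by
      rw [map_sum, hN, Complex.ofReal_sum]
      exact Finset.sum_congr rfl fun x _ => by rw [hφ, hval]
    have h2 : ‖∑ x ∈ s, lp.single (E := fun _ : X => ℂ) p x (f x)‖ ^ p.toReal = N := by
      rw [lp.norm_sum_single hp]
      exact Finset.sum_congr rfl fun x _ => norm_powModulus_rpow_toReal hq hp _
    have h3 : ‖∑ x ∈ s, lp.single (E := fun _ : X => ℂ) p x (f x)‖ = N ^ p.toReal⁻¹ := by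
      rw [← h2, Real.rpow_rpow_inv (norm_nonneg _) hp.ne']
    have h4 := φ.le_opNorm (∑ x ∈ s, lp.single (E := fun _ : X => ℂ) p x (f x))
    rw [h1, h3, Complex.norm_real, Real.norm_of_nonneg hN0] at h4
    have h5 : N ^ q.toReal⁻¹ ≤ ‖φ‖ := by
      have h6 : N = N ^ q.toReal⁻¹ * N ^ p.toReal⁻¹ := by
        rw [← Real.rpow_add h0, add_comm, h.inv_add_inv_eq_one, Real.rpow_one]
      refine le_of_mul_le_mul_right ?_ (show 0 < N ^ p.toReal⁻¹ by positivity)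
      rwa [← h6]
    calc N = (N ^ q.toReal⁻¹) ^ q.toReal := (Real.rpow_inv_rpow hN0 hq.ne').symm
      _ ≤ _ := by gcongr
  refine ⟨⟨b, hb⟩, lp.ext_continuousLinearMap (fun h' => ?_) fun x => ?_⟩
  · rw [h', ENNReal.toReal_top] at hp
    exact hp.ne rfl
  · ext
    exact (lpFunctional_single _ x 1).trans (hφ x 1).symm

end Duality

theorem dualRep_apply {G E : Type*} [Group G] [NormedAddCommGroup E] [NormedSpace ℂ E]
    (π : G →* (E ≃ₗᵢ[ℂ] E)) (g : G) (φ : StrongDual ℂ E) (v : E) :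
    dualRep π g φ v = φ (π g⁻¹ v) := by
  rw [map_inv]; rfl

theorem mem_invariants_dualRep {G E : Type*} [Group G] [NormedAddCommGroup E] [NormedSpace ℂ E]
    {π : G →* (E ≃ₗᵢ[ℂ] E)} {φ : StrongDual ℂ E} :
    φ ∈ invariants (dualRep π) ↔ ∀ g v, φ (π g v) = φ v := by
  constructor
  · intro h g v
    have h1 := congrArg (· v) (h g⁻¹)
    simpa only [dualRep_apply, inv_inv] using h1
  · exact fun h g => ContinuousLinearMap.ext fun v => by rw [dualRep_apply, h]

theorem apply_sub_mem_invariantComplement {G E : Type*} [Group G] [NormedAddCommGroup E]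
    [NormedSpace ℂ E] (π : G →* (E ≃ₗᵢ[ℂ] E)) (g : G) (v : E) :
    π g v - v ∈ invariantComplement π := fun φ hφ => by
  rw [map_sub, mem_invariants_dualRep.1 hφ, sub_self]

/-- A subspace on which no nonzero functional vanishes is dense. -/
theorem dense_of_forall_dual {E : Type*} [NormedAddCommGroup E] [NormedSpace ℂ E]
    (S : Submodule ℂ E) (hS : ∀ φ : StrongDual ℂ E, (∀ v ∈ S, φ v = 0) → φ = 0) (v : E) :
    v ∈ closure (S : Set E) := by
  have hcl : IsClosed (S.topologicalClosure : Set E) := S.isClosed_topologicalClosure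
  rw [← Submodule.topologicalClosure_coe]
  by_contra hv
  have hne : S.topologicalClosure.mkQ v ≠ 0 := fun h =>
    hv ((Submodule.Quotient.mk_eq_zero _).1 h)
  obtain ⟨ψ, hψ⟩ := SeparatingDual.exists_ne_zero (R := ℂ) hne
  have h0 := hS (ψ.comp S.topologicalClosure.mkQL) fun w hw => by
    have : S.topologicalClosure.mkQ w = 0 :=
      (Submodule.Quotient.mk_eq_zero _).2 (S.le_topologicalClosure hw)
    change ψ (S.topologicalClosure.mkQ w) = 0
    rw [this, map_zero]
  exact hψ (congrArg (· v) h0)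

namespace PhaseCocycle

variable {G X : Type*} [Group G] [MulAction G X] (c : PhaseCocycle G X)
  {p q : ℝ≥0∞} [Fact (1 ≤ p)] [Fact (1 ≤ q)]

section Dual

variable [q.HolderConjugate p] (h : p.toReal.HolderConjugate q.toReal)

/-- The conjugation in the pairing inverts the phases of `b`, so they cancel those of the other
vector; reindexing by `g⁻¹` does the rest. -/
theorem lpFunctional_mem_invariants {b : lp (fun _ : X => ℂ) q}
    (hb : b ∈ invariants (c.rep h.symm.pos)) :
    lpFunctional b ∈ invariants (dualRep (c.rep h.pos)) := by
  refine mem_invariants_dualRep.2 fun g f => ?_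
  rw [lpFunctional_apply, lpFunctional_apply,
    ← (MulAction.toPerm g⁻¹ : Equiv.Perm X).tsum_eq fun x => star (b x) * f x]
  refine tsum_congr fun x => ?_
  have h1 : b x = c g x * b (g⁻¹ • x) := by
    conv_lhs => rw [← hb g]
    rfl
  have h2 : star (c g x : ℂ) * c g x = 1 := by
    rw [Complex.star_def, Complex.conj_mul', Circle.norm_coe]
    simp
  rw [rep_apply, h1, star_mul', MulAction.toPerm_apply]
  linear_combination (star (b (g⁻¹ • x)) * f (g⁻¹ • x)) * h2

theorem mem_invariants_of_lpFunctional {b : lp (fun _ : X => ℂ) q}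
    (hb : lpFunctional b ∈ invariants (dualRep (c.rep h.pos))) :
    b ∈ invariants (c.rep h.symm.pos) := by
  classical
  refine fun g => lp.ext <| funext fun x => ?_
  have h1 := mem_invariants_dualRep.1 hb g⁻¹ (lp.single p x 1)
  rw [rep_single, lpFunctional_single, lpFunctional_single, mul_one, mul_one] at h1
  have h3 := congrArg star h1
  rw [star_mul', star_star, star_star] at h3
  have h4 : star (c g⁻¹ (g⁻¹ • x) : ℂ) = c g x := by
    have h5 := c.map_inv_mul g x
    rw [Complex.star_def, ← Circle.coe_inv_eq_conj, ← eq_inv_of_mul_eq_one_right h5]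
  rw [rep_apply, ← h3, h4, mul_comm]

/-- The Mazur image of `w` is an invariant functional of norm at most one; it kills `f` and takes
the value `1` at `w`. -/
theorem one_le_norm_sub_of_mem_invariants {f w : lp (fun _ : X => ℂ) p}
    (hf : f ∈ invariantComplement (c.rep h.pos)) (hw : w ∈ invariants (c.rep h.pos))
    (hw1 : ‖w‖ = 1) : 1 ≤ ‖f - w‖ := by
  have h1 := hf _ (c.lpFunctional_mem_invariants h
    (c.mazur_mem_invariants h.pos h.symm.pos hw))
  have h2 := norm_lpFunctional_apply_le (mazur q h.pos h.symm.pos w) (f - w)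
  rw [map_sub, h1, lpFunctional_mazur h, hw1, norm_mazur_eq_one _ _ hw1] at h2
  simpa using h2

/-- A functional vanishing on the complement kills all differences `π g f - f`, so it is invariant
and comes from an invariant `b` in `ℓ_q`. The Mazur image of `b` is then an invariant vector of
`ℓ_p`; vanishing of the functional there forces `b = 0`. Density suffices for the approximations
below. -/
theorem dense_invariants_sup_invariantComplement (v : lp (fun _ : X => ℂ) p) :
    v ∈ closure ((invariants (c.rep h.pos) ⊔ invariantComplement (c.rep h.pos) :
      Submodule ℂ (lp (fun _ : X => ℂ) p)) : Set (lp (fun _ : X => ℂ) p)) := by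
  refine dense_of_forall_dual _ (fun φ hφ => ?_) v
  obtain ⟨b, rfl⟩ := exists_lpFunctional_eq h φ
  have h1 : lpFunctional b ∈ invariants (dualRep (c.rep h.pos)) :=
    mem_invariants_dualRep.2 fun g f => sub_eq_zero.1 <| by
      rw [← map_sub]
      exact hφ _ (Submodule.mem_sup_right (apply_sub_mem_invariantComplement _ g f))
  have h2 := c.mem_invariants_of_lpFunctional h h1
  have h3 := hφ _ (Submodule.mem_sup_left (c.mazur_mem_invariants h.symm.pos h.pos h2))
  have h4 := lpFunctional_mazur h (mazur p h.symm.pos h.pos b)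
  rw [mazur_mazur, h3] at h4
  have h5 : ‖mazur p h.symm.pos h.pos b‖ ^ p.toReal = 0 := by exact_mod_cast h4.symm
  rw [norm_mazur_rpow, Real.rpow_eq_zero (norm_nonneg _) h.symm.pos.ne', norm_eq_zero] at h5
  rw [h5]
  ext f
  simp [lpFunctional_apply]

end Dual

end PhaseCocycle

/-! ### Almost invariant vectors -/

section AlmostInvariant

variable {G E : Type*} [Group G] [NormedAddCommGroup E] [NormedSpace ℂ E]

/-- Every compact set lies in some member of a compact exhaustion, so vectors moved by less than `1
/ (n + 1)` on the `n`-th member form the required sequence. -/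
theorem hasAlmostInvariantVectorsIn_iff [TopologicalSpace G] [WeaklyLocallyCompactSpace G]
    [SigmaCompactSpace G]
    {π : G →* (E ≃ₗᵢ[ℂ] E)} {S : Submodule ℂ E} :
    HasAlmostInvariantVectorsIn π S ↔ ∀ K : Set G, IsCompact K → ∀ ε > 0,
      ∃ v ∈ S, ‖v‖ = 1 ∧ ∀ g ∈ K, ‖π g v - v‖ < ε := by
  constructor
  · rintro ⟨f, hfS, hf1, hf⟩ K hK ε hε
    obtain ⟨n, hn⟩ := (Metric.tendstoUniformlyOn_iff.1 (hf K hK) ε hε).exists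
    refine ⟨f n, hfS n, hf1 n, fun g hg => ?_⟩
    simpa using hn g hg
  · intro h
    let Q := CompactExhaustion.choice G
    choose f hfS hf1 hf using fun n : ℕ => h (Q n) (Q.isCompact n) (1 / ((n : ℝ) + 1)) (by positivity)
    refine ⟨f, hfS, hf1, fun K hK => Metric.tendstoUniformlyOn_iff.2 fun ε hε => ?_⟩
    obtain ⟨m, hm⟩ := Q.exists_superset_of_isCompact hK
    filter_upwards [eventually_ge_atTop m,
      (tendsto_one_div_add_atTop_nhds_zero_nat (𝕜 := ℝ)).eventually (gt_mem_nhds hε)] with n hn hnε g hg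
    have h1 := hf n g (Q.subset hn (hm hg))
    rw [Real.dist_eq, zero_sub, abs_neg, abs_of_nonneg (norm_nonneg _)]
    exact h1.trans hnε

/-- Normalising multiplies displacements by at most `1 / δ`. -/
theorem exists_unit_norm_sub_lt {π : G →* (E ≃ₗᵢ[ℂ] E)} {S : Submodule ℂ E} {K : Set G}
    {v : E} {δ ε : ℝ} (hδ : 0 < δ) (hv : v ∈ S) (hδv : δ ≤ ‖v‖)
    (h : ∀ g ∈ K, ‖π g v - v‖ < ε * δ) :
    ∃ u ∈ S, ‖u‖ = 1 ∧ ∀ g ∈ K, ‖π g u - u‖ < ε := by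
  have hv0 : 0 < ‖v‖ := hδ.trans_le hδv
  refine ⟨((‖v‖⁻¹ : ℝ) : ℂ) • v, S.smul_mem _ hv, ?_, fun g hg => ?_⟩
  · rw [norm_smul, Complex.norm_real, Real.norm_of_nonneg (by positivity),
      inv_mul_cancel₀ hv0.ne']
  · have hε : 0 < ε * δ := (norm_nonneg _).trans_lt (h g hg)
    have hε' : 0 < ε := pos_of_mul_pos_left hε hδ.le
    rw [map_smul, ← smul_sub, norm_smul, Complex.norm_real, Real.norm_of_nonneg (by positivity),
      inv_mul_lt_iff₀ hv0, mul_comm]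
    exact (h g hg).trans_le (by gcongr)

end AlmostInvariant

theorem exists_holderConjugate {p : ℝ≥0∞} (h1 : 1 < p) (h2 : p < ∞) :
    ∃ q : ℝ≥0∞, Fact (1 ≤ q) ∧ q.HolderConjugate p ∧ p.toReal.HolderConjugate q.toReal := by
  have h := ENNReal.HolderConjugate.conjExponent h1.le
  have hp : 1 < p.toReal := by
    have := (ENNReal.toReal_lt_toReal ENNReal.one_ne_top h2.ne).2 h1
    rwa [ENNReal.toReal_one] at this
  exact ⟨_, ⟨ENNReal.HolderConjugate.one_le _ p⟩, h.symm, ENNReal.HolderConjugate.toReal hp⟩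

namespace PhaseCocycle

variable {G X : Type*} [Group G] [MulAction G X] (c : PhaseCocycle G X)
  {p q : ℝ≥0∞} [Fact (1 ≤ p)] [Fact (1 ≤ q)]

/-- The Mazur map sends the unit sphere of the complement of the invariant vectors of `ℓ_p` to a
set at positive distance from the invariant vectors of `ℓ_q`. -/
theorem exists_le_norm_mazur_sub (h1 : 1 < p) (h2 : p < ∞) (hp : 0 < p.toReal)
    (hq : 0 < q.toReal) :
    ∃ δ > 0, ∀ f ∈ invariantComplement (c.rep hp), ‖f‖ = 1 →
      ∀ v ∈ invariants (c.rep hq), δ ≤ ‖mazur q hp hq f - v‖ := by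
  obtain ⟨p', _, _, hpp⟩ := exists_holderConjugate h1 h2
  obtain ⟨δ, hδ, hM⟩ := exists_norm_mazur_sub_lt (X := X) hq hp one_pos
  -- The bound `1` forces a nearby invariant `v` to be nonzero; the half pays for replacing `v` by
  -- its normalisation `u`, which at most doubles the distance. Then the inverse Mazur map would put
  -- a unit invariant vector at distance less than `1` from `f`.
  refine ⟨min (δ / 2) 1, by positivity, fun f hf hf1 v hv => ?_⟩
  have hm1 := norm_mazur_eq_one hp hq hf1
  by_contra! hlt
  have hlt1 := hlt.trans_le (min_le_left _ _)
  have hlt2 := hlt.trans_le (min_le_right _ _)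
  have hv0 : 0 < ‖v‖ := by
    refine norm_pos_iff.2 ?_
    rintro rfl
    rw [sub_zero, hm1] at hlt2
    exact lt_irrefl _ hlt2
  set u : lp (fun _ : X => ℂ) q := ((‖v‖⁻¹ : ℝ) : ℂ) • v with hu
  have hui : u ∈ invariants (c.rep hq) := Submodule.smul_mem _ _ hv
  have hu1 : ‖u‖ = 1 := by
    rw [hu, norm_smul, Complex.norm_real, Real.norm_of_nonneg (by positivity),
      inv_mul_cancel₀ hv0.ne']
  have huv : ‖v - u‖ ≤ ‖mazur q hp hq f - v‖ := by
    have h3 : v - u = (((‖v‖ - 1 : ℝ) * ‖v‖⁻¹ : ℝ) : ℂ) • v := by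
      rw [hu, sub_mul, mul_inv_cancel₀ hv0.ne', one_mul, Complex.ofReal_sub, sub_smul,
        Complex.ofReal_one, one_smul]
    rw [h3, norm_smul, Complex.norm_real, norm_mul, Real.norm_of_nonneg (inv_nonneg.2 hv0.le),
      mul_assoc, inv_mul_cancel₀ hv0.ne', mul_one, ← hm1, Real.norm_eq_abs, norm_sub_rev]
    exact abs_norm_sub_norm_le _ _
  have h4 := hM _ _ hm1 hu1 (by
    have := norm_sub_le_norm_sub_add_norm_sub (mazur q hp hq f) v u
    linarith)
  rw [mazur_mazur] at h4
  exact h4.not_ge (c.one_le_norm_sub_of_mem_invariants hpp hf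
    (c.mazur_mem_invariants hq hp hui) (norm_mazur_eq_one _ _ hu1))

variable [TopologicalSpace G]

/-- The existence of almost invariant vectors in the complement of the invariant vectors does not
depend on the exponent. -/
theorem hasAlmostInvariantVectorsIn_rep [WeaklyLocallyCompactSpace G] [SigmaCompactSpace G]
    (h1 : 1 < p) (h2 : p < ∞) (h3 : 1 < q) (h4 : q < ∞)
    (hp : 0 < p.toReal) (hq : 0 < q.toReal)
    (h : HasAlmostInvariantVectorsIn (c.rep hp) (invariantComplement (c.rep hp))) :
    HasAlmostInvariantVectorsIn (c.rep hq) (invariantComplement (c.rep hq)) := by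
  rw [hasAlmostInvariantVectorsIn_iff] at h ⊢
  intro K hK ε hε
  obtain ⟨q', _, _, hqq⟩ := exists_holderConjugate h3 h4
  obtain ⟨δ, hδ, hfar⟩ := c.exists_le_norm_mazur_sub h1 h2 hp hq
  -- Half of the allowed displacement `ε * (δ / 2)` goes to the Mazur image, the other half to twice
  -- the error of the decomposition below.
  obtain ⟨η, hη, hM⟩ := exists_norm_mazur_sub_lt (X := X) hp hq
    (show 0 < ε * (δ / 2) / 2 by positivity)
  obtain ⟨f, hf, hf1, hfK⟩ := h K hK η hη
  have hfar' := hfar f hf hf1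
  have hinv : ∀ g ∈ K, ‖c.rep hq g (mazur q hp hq f) - mazur q hp hq f‖ < ε * (δ / 2) / 2 :=
    fun g hg => by
      rw [← mazur_rep]
      exact hM _ _ (by rw [LinearIsometryEquiv.norm_map, hf1]) hf1 (hfK g hg)
  generalize mazur q hp hq f = k at hfar' hinv
  obtain ⟨w, hw, hkw⟩ := Metric.mem_closure_iff.1
    (c.dense_invariants_sup_invariantComplement hqq k) (min (δ / 2) (ε * (δ / 2) / 4))
    (by positivity)
  obtain ⟨a, ha, b, hb, rfl⟩ := Submodule.mem_sup.1 hw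
  rw [dist_eq_norm] at hkw
  have hkw1 := hkw.trans_le (min_le_left _ _)
  have hkw2 := hkw.trans_le (min_le_right _ _)
  refine exists_unit_norm_sub_lt (half_pos hδ) hb ?_ fun g hg => ?_
  -- The Mazur image is at distance at least `δ` from the invariant vector `a`, and the
  -- decomposition loses less than `δ / 2`; so `b` has norm at least `δ / 2`.
  · have h5 := hfar' a ha
    have h6 : k - a = (k - (a + b)) + b := by abel
    rw [h6] at h5
    have := norm_add_le (k - (a + b)) b
    linarith
  · have h5 : c.rep hq g b - b = (c.rep hq g k - k) + ((k - (a + b)) -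
        c.rep hq g (k - (a + b))) := by
      rw [map_sub, map_add, ha g]
      abel
    have h6 := norm_add_le (c.rep hq g k - k) ((k - (a + b)) - c.rep hq g (k - (a + b)))
    have h7 := norm_sub_le (k - (a + b)) (c.rep hq g (k - (a + b)))
    rw [LinearIsometryEquiv.norm_map] at h7
    have h8 := hinv g hg
    rw [h5]
    linarith

/-- The orbit map of a unit vector is the Mazur image of an orbit map at exponent `p`, which stays
on the unit sphere where the Mazur map is uniformly continuous. Other vectors follow by scaling. -/
theorem continuous_rep_of_exponent (hp : 0 < p.toReal) (hq : 0 < q.toReal)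
    (h : ∀ f, Continuous fun g => c.rep hp g f) (f : lp (fun _ : X => ℂ) q) :
    Continuous fun g => c.rep hq g f := by
  have key : ∀ u : lp (fun _ : X => ℂ) q, ‖u‖ = 1 → Continuous fun g => c.rep hq g u := by
    intro u hu
    have hm1 := norm_mazur_eq_one hq hp hu
    have h1 : ∀ g, c.rep hq g u = mazur q hp hq (c.rep hp g (mazur p hq hp u)) := fun g => by
      rw [mazur_rep, mazur_mazur]
    simp only [h1]
    refine continuous_iff_continuousAt.2 fun g₀ => Metric.tendsto_nhds.2 fun ε hε => ?_
    obtain ⟨δ, hδ, hM⟩ := exists_norm_mazur_sub_lt (X := X) hp hq hε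
    filter_upwards [Metric.tendsto_nhds.1 ((h (mazur p hq hp u)).tendsto g₀) δ hδ] with g hg
    rw [dist_eq_norm] at hg ⊢
    exact hM _ _ (by rw [LinearIsometryEquiv.norm_map, hm1])
      (by rw [LinearIsometryEquiv.norm_map, hm1]) hg
  rcases eq_or_ne f 0 with rfl | hf
  · simpa using continuous_const
  · have hf0 : ‖f‖ ≠ 0 := norm_ne_zero_iff.2 hf
    have h1 : f = (‖f‖ : ℂ) • (((‖f‖⁻¹ : ℝ) : ℂ) • f) := by
      rw [smul_smul, ← Complex.ofReal_mul, mul_inv_cancel₀ hf0, Complex.ofReal_one, one_smul]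
    have h2 := key (((‖f‖⁻¹ : ℝ) : ℂ) • f) (by
      rw [norm_smul, Complex.norm_real, Real.norm_of_nonneg (by positivity),
        inv_mul_cancel₀ hf0])
    rw [h1]
    simp only [map_smul (_ : _ ≃ₗᵢ[ℂ] _) (‖f‖ : ℂ)]
    exact h2.const_smul (‖f‖ : ℂ)

end PhaseCocycle

/-! ### Isometries of `ℓ_p` for `p ≠ 2` -/

theorem rpow_add_rpow_lt_add_rpow {u v s : ℝ} (hu : 0 < u) (hv : 0 < v) (hs : 1 < s) :
    u ^ s + v ^ s < (u + v) ^ s := by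
  have h : ∀ w : ℝ, 0 < w → w ^ s = w * w ^ (s - 1) := fun w hw => by
    rw [Real.rpow_sub_one hw.ne', mul_div_cancel₀ _ hw.ne']
  have h1 : u ^ (s - 1) < (u + v) ^ (s - 1) :=
    Real.rpow_lt_rpow hu.le (by linarith) (by linarith)
  have h2 : v ^ (s - 1) < (u + v) ^ (s - 1) :=
    Real.rpow_lt_rpow hv.le (by linarith) (by linarith)
  rw [h u hu, h v hv, h (u + v) (by positivity), add_mul]
  gcongr

theorem add_rpow_lt_rpow_add_rpow {u v s : ℝ} (hu : 0 < u) (hv : 0 < v) (hs : s < 1) :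
    (u + v) ^ s < u ^ s + v ^ s := by
  have h : ∀ w : ℝ, 0 < w → w ^ s = w * w ^ (s - 1) := fun w hw => by
    rw [Real.rpow_sub_one hw.ne', mul_div_cancel₀ _ hw.ne']
  have h1 : (u + v) ^ (s - 1) < u ^ (s - 1) :=
    Real.rpow_lt_rpow_of_neg hu (by linarith) (by linarith)
  have h2 : (u + v) ^ (s - 1) < v ^ (s - 1) :=
    Real.rpow_lt_rpow_of_neg hv (by linarith) (by linarith)
  rw [h u hu, h v hv, h (u + v) (by positivity), add_mul]
  gcongr

/-- The defect in the parallelogram identity with exponent `r` has constant sign, and vanishes only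
if one of the two numbers does. -/
theorem exists_sign_mul_parallelogram {r : ℝ} (hr : 0 < r) (hr2 : r ≠ 2) :
    ∃ e : ℝ, ∀ a b : ℂ,
      0 ≤ e * (‖a + b‖ ^ r + ‖a - b‖ ^ r - 2 * (‖a‖ ^ r + ‖b‖ ^ r)) ∧
      (e * (‖a + b‖ ^ r + ‖a - b‖ ^ r - 2 * (‖a‖ ^ r + ‖b‖ ^ r)) = 0 → a = 0 ∨ b = 0) := by
  have hsq : ∀ z : ℂ, ‖z‖ ^ r = (‖z‖ ^ 2) ^ (r / 2) := fun z => by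
    rw [← Real.rpow_natCast, ← Real.rpow_mul (norm_nonneg z)]
    congr 1
    push_cast
    ring
  have hpar : ∀ a b : ℂ, (1 / 2 : ℝ) * ‖a + b‖ ^ 2 + (1 / 2 : ℝ) * ‖a - b‖ ^ 2 =
      ‖a‖ ^ 2 + ‖b‖ ^ 2 := fun a b => by
    have := parallelogram_law_with_norm ℂ a b
    simp only [sq]
    linarith
  have hzero : ∀ a b : ℂ, (a = 0 ∨ b = 0) →
      ‖a + b‖ ^ r + ‖a - b‖ ^ r - 2 * (‖a‖ ^ r + ‖b‖ ^ r) = 0 := by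
    rintro a b (rfl | rfl) <;> simp [Real.zero_rpow hr.ne'] <;> ring
  rcases lt_or_gt_of_ne hr2 with h | h
  -- Concavity of `x ↦ x ^ (r / 2)` and the parallelogram law bound the mean of `‖a + b‖ ^ r` and
  -- `‖a - b‖ ^ r` by `(‖a‖ ^ 2 + ‖b‖ ^ 2) ^ (r / 2)`, which is strictly below `‖a‖ ^ r + ‖b‖ ^ r`
  -- by subadditivity. For `r > 2` both inequalities reverse.
  · refine ⟨-1, fun a b => ?_⟩
    by_cases h0 : a = 0 ∨ b = 0
    · exact ⟨by rw [hzero a b h0, mul_zero], fun _ => h0⟩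
    have ha : 0 < ‖a‖ ^ 2 := by
      have := norm_pos_iff.2 fun h => h0 (Or.inl h)
      positivity
    have hb : 0 < ‖b‖ ^ 2 := by
      have := norm_pos_iff.2 fun h => h0 (Or.inr h)
      positivity
    have h1 := (Real.concaveOn_rpow (p := r / 2) (by positivity) (by linarith)).2
      (show ‖a + b‖ ^ 2 ∈ Set.Ici (0 : ℝ) from Set.mem_Ici.2 (sq_nonneg _))
      (show ‖a - b‖ ^ 2 ∈ Set.Ici (0 : ℝ) from Set.mem_Ici.2 (sq_nonneg _))
      (show (0 : ℝ) ≤ 1 / 2 by norm_num) (show (0 : ℝ) ≤ 1 / 2 by norm_num) (by norm_num)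
    simp only [smul_eq_mul] at h1
    rw [hpar, ← hsq, ← hsq] at h1
    have h2 := add_rpow_lt_rpow_add_rpow ha hb (show r / 2 < 1 by linarith)
    rw [← hsq, ← hsq] at h2
    exact ⟨by linarith, fun h3 => by linarith⟩
  · refine ⟨1, fun a b => ?_⟩
    by_cases h0 : a = 0 ∨ b = 0
    · exact ⟨by rw [hzero a b h0, mul_zero], fun _ => h0⟩
    have ha : 0 < ‖a‖ ^ 2 := by
      have := norm_pos_iff.2 fun h => h0 (Or.inl h)
      positivity
    have hb : 0 < ‖b‖ ^ 2 := by
      have := norm_pos_iff.2 fun h => h0 (Or.inr h)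
      positivity
    have h1 := (convexOn_rpow (p := r / 2) (by linarith)).2
      (show ‖a + b‖ ^ 2 ∈ Set.Ici (0 : ℝ) from Set.mem_Ici.2 (sq_nonneg _))
      (show ‖a - b‖ ^ 2 ∈ Set.Ici (0 : ℝ) from Set.mem_Ici.2 (sq_nonneg _))
      (show (0 : ℝ) ≤ 1 / 2 by norm_num) (show (0 : ℝ) ≤ 1 / 2 by norm_num) (by norm_num)
    simp only [smul_eq_mul] at h1
    rw [hpar, ← hsq, ← hsq] at h1
    have h2 := rpow_add_rpow_lt_add_rpow ha hb (show 1 < r / 2 by linarith)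
    rw [← hsq, ← hsq] at h2
    exact ⟨by linarith, fun h3 => by linarith⟩

section Lamperti

variable {X : Type*} {p : ℝ≥0∞}

/-- Disjointness of supports in `ℓ_p` can be read off from the norm if `p ≠ 2`. -/
theorem disjoint_support_iff (hp : 0 < p.toReal) (hp2 : p.toReal ≠ 2)
    (f g : lp (fun _ : X => ℂ) p) :
    (∀ x, f x = 0 ∨ g x = 0) ↔ ‖f + g‖ ^ p.toReal + ‖f - g‖ ^ p.toReal =
      2 * (‖f‖ ^ p.toReal + ‖g‖ ^ p.toReal) := by
  obtain ⟨e, he⟩ := exists_sign_mul_parallelogram hp hp2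
  have hs := (((lp.hasSum_norm hp (f + g)).add (lp.hasSum_norm hp (f - g))).sub
    (((lp.hasSum_norm hp f).add (lp.hasSum_norm hp g)).mul_left 2))
  constructor
  · intro h
    refine sub_eq_zero.1 (hs.unique ?_)
    convert hasSum_zero with x
    rw [lp.coeFn_add, lp.coeFn_sub, Pi.add_apply, Pi.sub_apply]
    rcases h x with h | h <;> rw [h] <;> simp [Real.zero_rpow hp.ne'] <;> ring
  · intro h x
    -- The coordinatewise defects have constant sign and sum to zero, so each of them vanishes.
    rw [h, sub_self] at hs
    have hs' := hs.mul_left e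
    rw [mul_zero] at hs'
    have h0 := (hasSum_zero_iff_of_nonneg fun x => (he (f x) (g x)).1).1 hs'
    exact (he (f x) (g x)).2 (congrFun h0 x)

theorem disjoint_support_map [Fact (1 ≤ p)] (hp : 0 < p.toReal) (hp2 : p.toReal ≠ 2)
    (U : lp (fun _ : X => ℂ) p ≃ₗᵢ[ℂ] lp (fun _ : X => ℂ) p) {f g : lp (fun _ : X => ℂ) p}
    (h : ∀ x, f x = 0 ∨ g x = 0) (x : X) : U f x = 0 ∨ U g x = 0 := by
  refine (disjoint_support_iff hp hp2 (U f) (U g)).2 ?_ x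
  rw [← map_add, ← map_sub]
  simp only [LinearIsometryEquiv.norm_map]
  exact (disjoint_support_iff hp hp2 f g).1 h

/-- **Banach–Lamperti**: a bijective isometry of `ℓ_p` with `p ≠ 2` permutes the elements of the
canonical basis up to phases. -/
theorem exists_map_single [Fact (1 ≤ p)] [DecidableEq X] (hp : 0 < p.toReal) (hp2 : p.toReal ≠ 2)
    (U : lp (fun _ : X => ℂ) p ≃ₗᵢ[ℂ] lp (fun _ : X => ℂ) p) (x : X) :
    ∃ (y : X) (u : Circle), U (lp.single p x 1) = lp.single p y (u : ℂ) := by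
  have hp0 : 0 < p := (ENNReal.toReal_pos_iff.1 hp).1
  set e : X → lp (fun _ : X => ℂ) p := fun x => lp.single p x 1 with he
  have hsm : ∀ y (a : ℂ), lp.single p y a = a • e y := fun y a => by
    rw [he, ← lp.single_smul, smul_eq_mul, mul_one]
  have he1 : ∀ x, ‖e x‖ = 1 := fun x => by rw [he, lp.norm_single hp0, norm_one]
  have hne : U (e x) ≠ 0 := fun h => by
    have := he1 x
    rw [← U.norm_map, h, norm_zero] at this
    exact zero_ne_one this
  obtain ⟨y, hy⟩ : ∃ y, U (e x) y ≠ 0 := by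
    by_contra! h
    exact hne (lp.ext (funext h))
  set f := U (e x) with hf
  -- Splitting off one coordinate of `f` gives two disjointly supported vectors. Their images under
  -- the inverse isometry are disjoint and add up to a basis vector, so the first image is a
  -- multiple of it.
  have hd := disjoint_support_map hp hp2 U.symm (f := lp.single p y (f y))
    (g := f - lp.single p y (f y)) fun z => by
      rw [lp.coeFn_sub, Pi.sub_apply]
      rcases eq_or_ne z y with rfl | hz
      · right; rw [lp.single_apply_self, sub_self]
      · left; rw [lp.single_apply_ne _ _ _ hz]
  have hsum : ∀ z, U.symm (lp.single p y (f y)) z + U.symm (f - lp.single p y (f y)) z = e x z :=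
    fun z => by
      rw [← Pi.add_apply, ← lp.coeFn_add, ← map_add, add_sub_cancel, hf, U.symm_apply_apply]
  have h1 : ∃ t : ℂ, U.symm (lp.single p y (f y)) = t • e x := by
    refine ⟨U.symm (lp.single p y (f y)) x, lp.ext (funext fun z => ?_)⟩
    rw [lp.coeFn_smul, Pi.smul_apply, smul_eq_mul]
    rcases eq_or_ne z x with rfl | hz
    · rw [he, lp.single_apply_self, mul_one]
    · have hez : e x z = 0 := lp.single_apply_ne _ _ _ hz
      have h2 := hsum z
      rw [hez] at h2 ⊢
      rcases hd z with h3 | h3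
      · rw [h3, mul_zero]
      · rw [h3, add_zero] at h2
        rw [h2, mul_zero]
  obtain ⟨t, ht⟩ := h1
  have h2 := congrArg U ht
  rw [U.apply_symm_apply, map_smul, ← hf, hsm] at h2
  have hc : t ≠ 0 := fun h => by
    rw [h, zero_smul, smul_eq_zero] at h2
    rcases h2 with h2 | h2
    · exact hy h2
    · have := he1 y
      rw [h2, norm_zero] at this
      exact zero_ne_one this
  have h3 : f = lp.single p y (t⁻¹ * f y) := by
    rw [hsm, mul_smul, h2, inv_smul_smul₀ hc]
  have h4 : ‖t⁻¹ * f y‖ = 1 := by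
    rw [← lp.norm_single (E := fun _ : X => ℂ) hp0 y, ← h3, hf, U.norm_map, he1]
  exact ⟨y, ⟨_, mem_sphere_zero_iff_norm.2 h4⟩, h3⟩

theorem single_inj [DecidableEq X] {x y : X} {a b : ℂ} (ha : a ≠ 0)
    (h : (lp.single p x a : lp (fun _ : X => ℂ) p) = lp.single p y b) : x = y ∧ a = b := by
  have h1 := congrArg (fun f : lp (fun _ : X => ℂ) p => f x) h
  simp only [lp.single_apply_self] at h1
  rcases eq_or_ne x y with rfl | hxy
  · rw [lp.single_apply_self] at h1
    exact ⟨rfl, h1⟩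
  · rw [lp.single_apply_ne _ _ _ hxy] at h1
    exact absurd h1 ha

/-- Every isometric representation on `ℓ_p` with `p ≠ 2` comes from an action with phases. -/
theorem exists_eq_rep [Fact (1 ≤ p)] {G : Type*} [Group G] (hp : 0 < p.toReal) (hp2 : p.toReal ≠ 2)
    (π : G →* (lp (fun _ : X => ℂ) p ≃ₗᵢ[ℂ] lp (fun _ : X => ℂ) p)) :
    ∃ (_ : MulAction G X) (c : PhaseCocycle G X), c.rep hp = π := by
  classical
  choose σ u hu using fun g : G => exists_map_single hp hp2 (π g)
  have hu' : ∀ g x (a : ℂ), π g (lp.single p x a) = lp.single p (σ g x) (a * u g x) :=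
    fun g x a => by
      have h1 : (lp.single p x a : lp (fun _ : X => ℂ) p) = a • lp.single p x (1 : ℂ) := by
        rw [← lp.single_smul, smul_eq_mul, mul_one]
      rw [h1, map_smul, hu, ← lp.single_smul, smul_eq_mul]
  have hone : ∀ x, x = σ 1 x := fun x =>
    (single_inj (p := p) one_ne_zero (by
      have := hu 1 x
      rw [map_one] at this
      exact this)).1
  have hmul : ∀ g h x, σ (g * h) x = σ g (σ h x) ∧ (u (g * h) x : ℂ) = u h x * u g (σ h x) :=
    fun g h x => single_inj (p := p) (Circle.coe_ne_zero _) (by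
      rw [← hu, ← hu', ← hu, map_mul]
      rfl)
  let act : MulAction G X :=
    { smul := σ
      one_smul := fun x => (hone x).symm
      mul_smul := fun g h x => (hmul g h x).1 }
  have hsm : ∀ (g : G) (x : X), g • x = σ g x := fun _ _ => rfl
  -- `u g` is indexed by the source of the basis vector, the cocycle by its target, hence the shift
  -- by `g⁻¹`.
  let c : PhaseCocycle G X :=
    { toFun := fun g x => u g (g⁻¹ • x)
      map_mul' := fun g h x => Circle.ext <| by
        rw [(hmul g h _).2, Circle.coe_mul, ← hsm h, mul_inv_rev, mul_smul, smul_inv_smul,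
          mul_comm] }
  refine ⟨act, c, MonoidHom.ext fun g => ?_⟩
  have h1 : ((c.rep hp g).toContinuousLinearEquiv :
      lp (fun _ : X => ℂ) p →L[ℂ] lp (fun _ : X => ℂ) p) = (π g).toContinuousLinearEquiv := by
    refine lp.ext_continuousLinearMap (fun h => ?_) fun x => ContinuousLinearMap.ext_ring ?_
    · rw [h, ENNReal.toReal_top] at hp
      exact hp.ne rfl
    · change c.rep hp g (lp.single p x 1) = π g (lp.single p x 1)
      rw [c.rep_single, hu, mul_one]
      change lp.single (E := fun _ : X => ℂ) p (g • x) (u g (g⁻¹ • g • x) : ℂ) = _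
      rw [inv_smul_smul, hsm]
  exact LinearIsometryEquiv.ext fun f => congrArg (fun T => T f) h1

end Lamperti

/-! ### Averaging almost invariant vectors -/

section Averaging

open MeasureTheory
open scoped Pointwise

variable {G : Type*} [Group G] [TopologicalSpace G] [IsTopologicalGroup G] [T2Space G]

/-- By left invariance, applying `π k` to the average over `B` gives the average over `k • B`, a
subset of `Q`. A mean displacement over `Q` thus controls the average uniformly in `k`. -/
theorem norm_map_average_sub_le [MeasurableSpace G] [BorelSpace G] (μ : Measure G)
    [μ.IsMulLeftInvariant] [IsFiniteMeasureOnCompacts μ] {E : Type*} [NormedAddCommGroup E]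
    [InnerProductSpace ℂ E] [CompleteSpace E] (π : G →* (E ≃ₗᵢ[ℂ] E)) (v : E)
    (hv : Continuous fun g => π g v) {B Q : Set G} (hB : IsCompact B) (hQ : IsCompact Q)
    (hμB : 0 < μ.real B) (k : G) (hk : k • B ⊆ Q) :
    ‖π k ((((μ.real B)⁻¹ : ℝ) : ℂ) • ∫ h in B, π h v ∂μ) - v‖ ≤
      (μ.real B)⁻¹ * ∫ g in Q, ‖π g v - v‖ ∂μ := by
  have hint : IntegrableOn (fun h => π (k * h) v) B μ :=
    (hv.comp (continuous_const_mul k)).continuousOn.integrableOn_compact hB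
  have h0 : ((μ.real B : ℝ) : ℂ) ≠ 0 := by exact_mod_cast hμB.ne'
  have h1 : π k ((((μ.real B)⁻¹ : ℝ) : ℂ) • ∫ h in B, π h v ∂μ) - v =
      (((μ.real B)⁻¹ : ℝ) : ℂ) • ∫ h in B, (π (k * h) v - v) ∂μ := by
    have h2 : π k (∫ h in B, π h v ∂μ) = ∫ h in B, π (k * h) v ∂μ := by
      have h3 := ((π k).toContinuousLinearEquiv : E →L[ℂ] E).integral_comp_comm
        (μ := μ.restrict B) (φ := fun h => π h v) (hv.continuousOn.integrableOn_compact hB)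
      refine h3.symm.trans (integral_congr_ae (Eventually.of_forall fun h => ?_))
      change π k (π h v) = π (k * h) v
      rw [map_mul]
      rfl
    have h4 : IntegrableOn (fun _ : G => v) B μ :=
      continuous_const.continuousOn.integrableOn_compact hB
    rw [map_smul, h2, integral_sub hint h4, setIntegral_const, smul_sub]
    congr 1
    rw [← Complex.coe_smul, smul_smul, Complex.ofReal_inv, inv_mul_cancel₀ h0, one_smul]
  rw [h1, norm_smul, Complex.norm_real, Real.norm_of_nonneg (by positivity)]
  gcongr
  have hcn : Continuous fun g => ‖π g v - v‖ := (hv.sub continuous_const).norm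
  calc ‖∫ h in B, (π (k * h) v - v) ∂μ‖ ≤ ∫ h in B, ‖π (k * h) v - v‖ ∂μ :=
        norm_integral_le_integral_norm _
    _ = ∫ g in k • B, ‖π g v - v‖ ∂μ := by
        rw [← (measurePreserving_mul_left μ k).setIntegral_preimage_emb
          (measurableEmbedding_mulLeft k) (fun g => ‖π g v - v‖)]
        have h5 : (fun x => k * x) ⁻¹' (k • B) = B :=
          Set.preimage_image_eq B (mul_right_injective k)
        rw [h5]
    _ ≤ ∫ g in Q, ‖π g v - v‖ ∂μ :=
        setIntegral_mono_set (hcn.continuousOn.integrableOn_compact hQ)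
          (Eventually.of_forall fun g => norm_nonneg _) (LE.le.eventuallyLE hk)

/-- If a direct sum of unitary representations has almost invariant vectors, then some summand has
almost invariant vectors. -/
theorem exists_almost_invariant_summand [LocallyCompactSpace G] {K : Set G} (hK : IsCompact K)
    {ε : ℝ} (hε : 0 < ε) :
    ∃ Q : Set G, IsCompact Q ∧ ∃ δ > 0, ∀ {ι : Type*} (F : Finset ι) (E : ι → Type*)
      [∀ i, NormedAddCommGroup (E i)] [∀ i, InnerProductSpace ℂ (E i)] [∀ i, CompleteSpace (E i)]
      (π : ∀ i, G →* (E i ≃ₗᵢ[ℂ] E i)) (v : ∀ i, E i),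
      (∀ i, Continuous fun g => π i g (v i)) → 1 / 2 ≤ ∑ i ∈ F, ‖v i‖ ^ 2 →
      (∀ g ∈ Q, ∑ i ∈ F, ‖π i g (v i) - v i‖ ^ 2 ≤ δ ^ 2) →
      ∃ i ∈ F, ∃ u : E i, ‖u‖ = 1 ∧ ∀ g ∈ K, ‖π i g u - u‖ < ε := by
  borelize G
  let μ : Measure G := Measure.haar
  obtain ⟨B, hB, hB1⟩ := exists_compact_mem_nhds (1 : G)
  -- Including `1` ensures that the average itself is close to the original vector.
  set Q : Set G := insert 1 K * B with hQdef
  have hQ : IsCompact Q := (hK.insert 1).mul hB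
  have hkQ : ∀ k ∈ insert 1 K, k • B ⊆ Q := fun k hk => Set.smul_set_subset_mul hk
  have hBQ : B ⊆ Q := by simpa using hkQ 1 (Set.mem_insert _ _)
  have hμB : 0 < μ.real B := ENNReal.toReal_pos (Measure.measure_pos_of_mem_nhds μ hB1).ne'
    hB.measure_lt_top.ne
  have hμQ : 0 < μ.real Q := hμB.trans_le (measureReal_mono hBQ hQ.measure_lt_top.ne)
  -- The `1 / 2` keeps the average at least half as long as `v i`; the `ε / 8` bounds its
  -- displacement by `ε / 4 * ‖v i‖`, below the required `ε * (‖v i‖ / 2)`.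
  set η := min (1 / 2) (ε / 8) with hη
  have hη0 : 0 < η := by positivity
  refine ⟨Q, hQ, η * μ.real B / (2 * μ.real Q), by positivity, ?_⟩
  intro ι F E _ _ _ π v hcont hsum hQs
  set δ := η * μ.real B / (2 * μ.real Q) with hδ
  have hδ0 : 0 < δ := by positivity
  have hcn : ∀ i, Continuous fun g => ‖π i g (v i) - v i‖ := fun i =>
    ((hcont i).sub continuous_const).norm
  have hint2 : ∀ i, IntegrableOn (fun g => ‖π i g (v i) - v i‖ ^ 2) Q μ := fun i =>
    ((hcn i).pow 2).continuousOn.integrableOn_compact hQ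
  have htot : ∑ i ∈ F, ∫ g in Q, ‖π i g (v i) - v i‖ ^ 2 ∂μ ≤ δ ^ 2 * μ.real Q := by
    rw [← integral_finsetSum _ fun i _ => hint2 i]
    refine (setIntegral_mono_on (integrable_finsetSum _ fun i _ => hint2 i)
      (integrableOn_const hQ.measure_lt_top.ne) hQ.measurableSet hQs).trans ?_
    rw [setIntegral_const, smul_eq_mul, mul_comm]
  -- The good summand may depend on `g`; integrating over `Q` before comparing sums selects one for
  -- all `g` at once. With `∑ ‖v i‖ ^ 2 ≥ 1 / 2`, the factor `4` leaves room for strictness.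
  obtain ⟨i, hi, hlt⟩ : ∃ i ∈ F, ∫ g in Q, ‖π i g (v i) - v i‖ ^ 2 ∂μ <
      4 * δ ^ 2 * μ.real Q * ‖v i‖ ^ 2 := by
    refine Finset.exists_lt_of_sum_lt (htot.trans_lt ?_)
    rw [← Finset.mul_sum]
    have : 0 < δ ^ 2 * μ.real Q := by positivity
    nlinarith
  have hn : 0 < ‖v i‖ := by
    refine norm_pos_iff.2 fun h => ?_
    rw [h, norm_zero] at hlt
    have := setIntegral_nonneg (μ := μ) hQ.measurableSet fun g (_ : g ∈ Q) =>
      sq_nonneg ‖π i g (v i) - v i‖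
    rw [h] at this
    linarith
  have hD : ∫ g in Q, ‖π i g (v i) - v i‖ ∂μ ≤ 2 * δ * ‖v i‖ * μ.real Q := by
    -- A pointwise arithmetic-geometric mean inequality, in place of Cauchy–Schwarz, passes from the
    -- square mean to the mean.
    have h1 : ∀ g ∈ Q, ‖π i g (v i) - v i‖ ≤
        δ * ‖v i‖ + (4 * δ * ‖v i‖)⁻¹ * ‖π i g (v i) - v i‖ ^ 2 := fun g _ => by
      have h2 : δ * ‖v i‖ + (4 * δ * ‖v i‖)⁻¹ * ‖π i g (v i) - v i‖ ^ 2 -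
          ‖π i g (v i) - v i‖ =
          (4 * δ * ‖v i‖)⁻¹ * (‖π i g (v i) - v i‖ - 2 * (δ * ‖v i‖)) ^ 2 := by
        field_simp
        ring
      have h3 : 0 ≤ (4 * δ * ‖v i‖)⁻¹ * (‖π i g (v i) - v i‖ - 2 * (δ * ‖v i‖)) ^ 2 := by
        positivity
      linarith
    have hc : IntegrableOn (fun _ : G => δ * ‖v i‖) Q μ :=
      integrableOn_const hQ.measure_lt_top.ne
    have h4 := setIntegral_mono_on ((hcn i).continuousOn.integrableOn_compact hQ)
      (hc.add ((hint2 i).const_mul _)) hQ.measurableSet h1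
    rw [integral_add' hc ((hint2 i).const_mul _), setIntegral_const, smul_eq_mul,
      integral_const_mul] at h4
    have h5 : (4 * δ * ‖v i‖)⁻¹ * ∫ g in Q, ‖π i g (v i) - v i‖ ^ 2 ∂μ ≤
        (4 * δ * ‖v i‖)⁻¹ * (4 * δ ^ 2 * μ.real Q * ‖v i‖ ^ 2) := by gcongr
    have h6 : (4 * δ * ‖v i‖)⁻¹ * (4 * δ ^ 2 * μ.real Q * ‖v i‖ ^ 2) =
        δ * ‖v i‖ * μ.real Q := by field_simp
    linarith
  set w : E i := (((μ.real B)⁻¹ : ℝ) : ℂ) • ∫ h in B, π i h (v i) ∂μ with hw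
  have hkw : ∀ k ∈ insert 1 K, ‖π i k w - v i‖ ≤ η * ‖v i‖ := fun k hk => by
    refine (norm_map_average_sub_le μ (π i) (v i) (hcont i) hB hQ hμB k (hkQ k hk)).trans ?_
    have h1 : (μ.real B)⁻¹ * ∫ g in Q, ‖π i g (v i) - v i‖ ∂μ ≤
        (μ.real B)⁻¹ * (2 * δ * ‖v i‖ * μ.real Q) := by gcongr
    have h2 : (μ.real B)⁻¹ * (2 * δ * ‖v i‖ * μ.real Q) = η * ‖v i‖ := by
      rw [hδ]; field_simp
    linarith
  have hw1 : ‖w - v i‖ ≤ η * ‖v i‖ := by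
    have := hkw 1 (Set.mem_insert _ _)
    rwa [map_one] at this
  have hη1 : η * ‖v i‖ ≤ 1 / 2 * ‖v i‖ := by gcongr; exact min_le_left _ _
  have hη2 : η * ‖v i‖ ≤ ε / 8 * ‖v i‖ := by gcongr; exact min_le_right _ _
  refine ⟨i, hi, ?_⟩
  obtain ⟨u, -, hu⟩ := exists_unit_norm_sub_lt (π := π i) (S := ⊤) (K := K) (v := w) (ε := ε)
    (half_pos hn) trivial (by
      have := norm_sub_norm_le (v i) w
      rw [norm_sub_rev] at this
      linarith) fun g hg => by
      have h1 := hkw g (Set.mem_insert_of_mem _ hg)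
      have h2 := norm_sub_le (π i g w - v i) (w - v i)
      rw [sub_sub_sub_cancel_right] at h2
      have : 0 < ε * ‖v i‖ := by positivity
      linarith
  exact ⟨u, hu⟩

end Averaging

/-! ### Orbit decomposition of `ℓ_2` into monomial representations -/

/-- Monomial representations associated to open subgroups have, in the complements of their
invariant vectors, unit vectors which are arbitrarily little moved by compact subsets of `G`. -/
def HasAlmostInvariantMonomialReps (G : Type*) [Group G] [TopologicalSpace G] : Prop :=
  ∀ K : Set G, IsCompact K → ∀ ε > 0, ∃ (i : Σ H : OpenSubgroup G, H →ₜ* Circle),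
    ∃ u : (invariants (indHom i.2))ᗮ, ‖u‖ = 1 ∧ ∀ g ∈ K, ‖restrictPerp (indHom i.2) g u - u‖ < ε

theorem lp_two_hasSum_norm_sq {ι : Type*} {E : ι → Type*} [∀ i, NormedAddCommGroup (E i)]
    (f : lp E 2) : HasSum (fun i => ‖f i‖ ^ 2) (‖f‖ ^ 2) := by
  simpa using lp.hasSum_norm (p := 2) (by norm_num) f

theorem continuous_restrictPerp {G E : Type*} [Group G] [TopologicalSpace G]
    [NormedAddCommGroup E] [InnerProductSpace ℂ E] {π : G →* (E ≃ₗᵢ[ℂ] E)}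
    (hπ : ∀ v, Continuous fun g => π g v) (v : (invariants π)ᗮ) :
    Continuous fun g => restrictPerp π g v :=
  Continuous.subtype_mk (hπ v) _

/-- Equivariant bounded operators preserve the complements of the invariant vectors. -/
theorem map_mem_invariantComplement {G E F : Type*} [Group G] [NormedAddCommGroup E]
    [NormedSpace ℂ E] [NormedAddCommGroup F] [NormedSpace ℂ F] {π : G →* (E ≃ₗᵢ[ℂ] E)}
    {ρ : G →* (F ≃ₗᵢ[ℂ] F)} (T : E →L[ℂ] F) (hT : ∀ g v, T (π g v) = ρ g (T v)) {v : E}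
    (hv : v ∈ invariantComplement π) : T v ∈ invariantComplement ρ := fun φ hφ =>
  hv (φ.comp T) <| mem_invariants_dualRep.2 fun g w => by
    rw [ContinuousLinearMap.comp_apply, hT, mem_invariants_dualRep.1 hφ]
    rfl

/-- For unitary representations the complement of the invariant vectors is the orthogonal
complement. -/
theorem invariantComplement_eq_orthogonal {G E : Type*} [Group G] [NormedAddCommGroup E]
    [InnerProductSpace ℂ E] [CompleteSpace E] (π : G →* (E ≃ₗᵢ[ℂ] E)) :
    invariantComplement π = (invariants π)ᗮ := by
  ext v
  rw [Submodule.mem_orthogonal]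
  constructor
  · intro hv w hw
    refine hv (innerSL ℂ w) (mem_invariants_dualRep.2 fun g u => ?_)
    rw [innerSL_apply_apply, innerSL_apply_apply]
    conv_lhs => rw [← hw g]
    exact LinearIsometryEquiv.inner_map_map _ _ _
  · intro hv φ hφ
    rw [← (InnerProductSpace.toDual ℂ E).apply_symm_apply φ, InnerProductSpace.toDual_apply_apply]
    refine hv _ fun g => ext_inner_right ℂ fun u => ?_
    have h1 := mem_invariants_dualRep.1 hφ g⁻¹ u
    rw [← InnerProductSpace.toDual_symm_apply, ← InnerProductSpace.toDual_symm_apply] at h1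
    rw [← h1, map_inv, ← LinearIsometryEquiv.inner_map_map (π g) _ ((π g)⁻¹ u)]
    congr 1
    exact ((π g).apply_symm_apply u).symm

namespace PhaseCocycle

variable {G X : Type*} [Group G] [MulAction G X] [TopologicalSpace G]
  (c : PhaseCocycle G X) {p : ℝ≥0∞} [Fact (1 ≤ p)]

/-- Stabilizers are open and the phases are continuous on them. -/
structure IsContinuous : Prop where
  isOpen_stabilizer : ∀ x : X, IsOpen (MulAction.stabilizer G x : Set G)
  continuousOn : ∀ x : X, ContinuousOn (fun g => c g x) (MulAction.stabilizer G x : Set G)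

/-- The diagonal matrix coefficient at `x` equals the phase on the stabilizer of `x` and `0` off it,
and it is continuous in `g`. -/
theorem isContinuous_of_continuous_rep (hp : 0 < p.toReal)
    (h : ∀ f, Continuous fun g => c.rep hp g f) : c.IsContinuous := by
  classical
  suffices hx : ∀ x : X, IsOpen (MulAction.stabilizer G x : Set G) ∧
      ContinuousOn (fun g => c g x) (MulAction.stabilizer G x : Set G) from
    ⟨fun x => (hx x).1, fun x => (hx x).2⟩
  intro x
  have h1 : Continuous fun g => c.rep hp g (lp.single p x 1) x :=
    (lp.evalCLM ℂ (fun _ : X => ℂ) p x).continuous.comp (h (lp.single p x 1))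
  have h2 : ∀ g, g ∈ MulAction.stabilizer G x →
      c.rep hp g (lp.single p x 1) x = (c g x : ℂ) := fun g hg => by
    rw [rep_apply, MulAction.mem_stabilizer_iff.1 (inv_mem hg), lp.single_apply_self, mul_one]
  have h3 : (MulAction.stabilizer G x : Set G) =
      {g | c.rep hp g (lp.single p x 1) x ≠ 0} := by
    ext g
    constructor
    · intro hg
      rw [Set.mem_ofPred_eq, h2 g hg]
      exact Circle.coe_ne_zero _
    · intro hg
      by_contra hg'
      refine hg ?_
      rw [rep_apply, lp.single_apply_ne, mul_zero]
      exact fun h => hg' (by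
        rw [SetLike.mem_coe, MulAction.mem_stabilizer_iff]
        conv_lhs => rw [← h]
        rw [smul_inv_smul])
  refine ⟨?_, ?_⟩
  · rw [h3]
    exact isOpen_ne_fun h1 continuous_const
  · refine Topology.IsInducing.subtypeVal.continuousOn_iff.2 ?_
    exact h1.continuousOn.congr fun g hg => (h2 g hg).symm

variable {c} (hc : c.IsContinuous)

/-- The stabilizer of a point, as an open subgroup. -/
def IsContinuous.openStabilizer (x : X) : OpenSubgroup G :=
  ⟨MulAction.stabilizer G x, hc.isOpen_stabilizer x⟩

/-- The character of the stabilizer of a point given by the phases. -/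
def IsContinuous.stabilizerChar (x : X) : hc.openStabilizer x →ₜ* Circle where
  toFun h := c h x
  map_one' := c.map_one x
  map_mul' g h := by
    have hg : (g : G)⁻¹ • x = x := MulAction.mem_stabilizer_iff.1 (inv_mem g.2)
    change c ((g : G) * h) x = _
    rw [c.map_mul, hg]
  continuous_toFun := continuousOn_iff_continuous_domRestrict.1 (hc.continuousOn x)

theorem IsContinuous.coe_stabilizerChar (x : X) (h : hc.openStabilizer x) :
    hc.stabilizerChar x h = c h x := rfl

/-- This is the equivariance under the stabilizer which places `y ↦ (y⁻¹ f) x` in the induced space.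
-/
theorem rep_two_orbit_mul (x : X) (f : lp (fun _ : X => ℂ) 2) (y : G) (h : hc.openStabilizer x) :
    c.rep (p := 2) (by norm_num) (y * h)⁻¹ f x =
      ((hc.stabilizerChar x h)⁻¹ : Circle) * c.rep (p := 2) (by norm_num) y⁻¹ f x := by
  have hx : (h : G) • x = x := MulAction.mem_stabilizer_iff.1 h.2
  have h1 := c.map_inv_mul (h : G) x
  rw [MulAction.mem_stabilizer_iff.1 (inv_mem h.2)] at h1
  rw [rep_apply, rep_apply, mul_inv_rev, map_mul, inv_inv, hx, hc.coe_stabilizerChar,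
    ← eq_inv_of_mul_eq_one_left h1, Circle.coe_mul, mul_inv_rev, inv_inv, inv_inv, mul_smul, hx,
    mul_assoc]

theorem norm_rep_out (x : X) (f : lp (fun _ : X => ℂ) 2)
    (q : G ⧸ (hc.openStabilizer x : Subgroup G)) :
    ‖c.rep (p := 2) (by norm_num) (Quotient.out q)⁻¹ f x‖ =
      ‖f (MulAction.ofQuotientStabilizer G x q)‖ := by
  rw [rep_apply, norm_mul, Circle.norm_coe, one_mul, inv_inv]
  conv_rhs => rw [← QuotientGroup.out_eq' q]
  rfl

theorem memℓp_rep_out (x : X) (f : lp (fun _ : X => ℂ) 2) :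
    Memℓp (fun q : G ⧸ (hc.openStabilizer x : Subgroup G) =>
      c.rep (p := 2) (by norm_num) (Quotient.out q)⁻¹ f x) 2 := by
  rw [memℓp_gen_iff (by norm_num)]
  simp only [norm_rep_out]
  exact ((lp.memℓp f).summable (by norm_num)).comp_injective
    (MulAction.injective_ofQuotientStabilizer G x)

/-- The component of an element of `ℓ_2` at the orbit of `x`, as an element of the monomial
representation associated to the stabilizer of `x`. -/
def IsContinuous.orbitComponent (x : X) :
    lp (fun _ : X => ℂ) 2 →ₗ[ℂ] IndSpace (hc.stabilizerChar x) where
  toFun f := (⟨fun y => c.rep (p := 2) (by norm_num) y⁻¹ f x, rep_two_orbit_mul hc x f,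
    memℓp_rep_out hc x f⟩ : indSubmodule (hc.stabilizerChar x))
  map_add' _ _ := DFunLike.ext _ _ fun y => mul_add _ _ _
  map_smul' _ _ := DFunLike.ext _ _ fun y => mul_left_comm _ _ _

theorem IsContinuous.orbitComponent_apply (x : X) (f : lp (fun _ : X => ℂ) 2) (y : G) :
    hc.orbitComponent x f y = c.rep (p := 2) (by norm_num) y⁻¹ f x := rfl

theorem IsContinuous.orbitComponent_rep (x : X) (g : G) (f : lp (fun _ : X => ℂ) 2) :
    hc.orbitComponent x (c.rep (by norm_num) g f) =
      indHom (hc.stabilizerChar x) g (hc.orbitComponent x f) :=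
  DFunLike.ext _ _ fun y => by
    rw [indHom_apply, hc.orbitComponent_apply, hc.orbitComponent_apply, mul_inv_rev, inv_inv,
      _root_.map_mul]
    rfl

theorem IsContinuous.hasSum_norm_orbitComponent (x : X) (f : lp (fun _ : X => ℂ) 2) :
    HasSum (fun q : G ⧸ MulAction.stabilizer G x => ‖f (MulAction.ofQuotientStabilizer G x q)‖ ^ 2)
      (‖hc.orbitComponent x f‖ ^ 2) := by
  have h1 := lp_two_hasSum_norm_sq (IndSpace.toL2 _ (hc.orbitComponent x f))
  have h2 : ∀ q, ‖IndSpace.toL2 _ (hc.orbitComponent x f) q‖ =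
      ‖f (MulAction.ofQuotientStabilizer G x q)‖ := norm_rep_out hc x f
  simp only [h2] at h1
  exact h1

/-- The set `X` is the disjoint union of its orbits, each of them a coset space of a stabilizer, so
the sum of the `|f x| ^ 2` can be regrouped. -/
theorem IsContinuous.hasSum_norm_sq (f : lp (fun _ : X => ℂ) 2) :
    HasSum (fun ω : MulAction.orbitRel.Quotient G X => ‖hc.orbitComponent ω.out f‖ ^ 2)
      (‖f‖ ^ 2) := by
  have h1 := (MulAction.selfEquivSigmaOrbitsQuotientStabilizer G X).symm.hasSum_iff.2
    (lp_two_hasSum_norm_sq f)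
  refine h1.sigma fun ω => ?_
  exact hc.hasSum_norm_orbitComponent _ f

end PhaseCocycle

theorem directSum_single {G ι : Type*} [Group G] {E : ι → Type*} [∀ i, NormedAddCommGroup (E i)]
    [∀ i, InnerProductSpace ℂ (E i)] [DecidableEq ι] (π : ∀ i, G →* (E i ≃ₗᵢ[ℂ] E i)) (g : G) (i : ι)
    (u : E i) : directSum π g (lp.single 2 i u) = lp.single 2 i (π i g u) :=
  lp.ext <| funext fun j => by
    change π j g _ = _
    rcases eq_or_ne j i with rfl | hj
    · rw [lp.single_apply_self, lp.single_apply_self]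
    · rw [lp.single_apply_ne _ _ _ hj, lp.single_apply_ne _ _ _ hj, map_zero]

/-- A direct sum of unitary representations has almost invariant vectors if and only if its
summands have vectors which are arbitrarily little moved by compact sets. -/
theorem hasAlmostInvariantVectorsIn_directSum_iff {G ι : Type*} [Group G] [TopologicalSpace G]
    [IsTopologicalGroup G] [LocallyCompactSpace G] [T2Space G] [SigmaCompactSpace G]
    {E : ι → Type*} [∀ i, NormedAddCommGroup (E i)] [∀ i, InnerProductSpace ℂ (E i)]
    [∀ i, CompleteSpace (E i)] (π : ∀ i, G →* (E i ≃ₗᵢ[ℂ] E i))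
    (hπ : ∀ i v, Continuous fun g => π i g v) :
    HasAlmostInvariantVectorsIn (directSum π) ⊤ ↔ ∀ K : Set G, IsCompact K → ∀ ε > 0,
      ∃ i, ∃ u : E i, ‖u‖ = 1 ∧ ∀ g ∈ K, ‖π i g u - u‖ < ε := by
  classical
  rw [hasAlmostInvariantVectorsIn_iff]
  constructor
  · intro h K hK ε hε
    obtain ⟨Q, hQ, δ, hδ, hsum⟩ := exists_almost_invariant_summand hK hε
    obtain ⟨f, -, hf1, hfQ⟩ := h Q hQ δ hδ
    have h1 := lp_two_hasSum_norm_sq f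
    rw [hf1, one_pow] at h1
    -- Finitely many summands already carry half of the squared norm, which is all that the
    -- averaging result needs.
    obtain ⟨F, hF⟩ := (h1.eventually (lt_mem_nhds (show (1 / 2 : ℝ) < 1 by norm_num))).exists
    have h3 : ∀ g ∈ Q, ∑ i ∈ F, ‖π i g (f i) - f i‖ ^ 2 ≤ δ ^ 2 := fun g hg => by
      have h2 := sum_le_hasSum F (fun _ _ => sq_nonneg _)
        (lp_two_hasSum_norm_sq (directSum π g f - f))
      exact h2.trans (by have := (hfQ g hg).le; gcongr)
    obtain ⟨i, -, u, hu⟩ := hsum F E π (fun i => f i) (fun i => hπ i _) hF.le h3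
    exact ⟨i, u, hu⟩
  · intro h K hK ε hε
    obtain ⟨i, u, hu, huK⟩ := h K hK ε hε
    refine ⟨lp.single 2 i u, trivial, ?_, fun g hg => ?_⟩
    · rw [lp.norm_single (by norm_num), hu]
    · rw [directSum_single, ← lp.single_sub, lp.norm_single (by norm_num)]
      exact huK g hg

namespace PhaseCocycle

variable {G X : Type*} [Group G] [MulAction G X] [TopologicalSpace G]
  {c : PhaseCocycle G X} (hc : c.IsContinuous)

/-- Restriction to an orbit is an equivariant contraction, so invariant functionals pull back to
invariant functionals. -/
theorem IsContinuous.orbitComponent_mem_orthogonal (ω : MulAction.orbitRel.Quotient G X)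
    {f : lp (fun _ : X => ℂ) 2} (hf : f ∈ invariantComplement (c.rep (p := 2) (by norm_num))) :
    hc.orbitComponent ω.out f ∈ (invariants (indHom (hc.stabilizerChar ω.out)))ᗮ := by
  have hle : ∀ f, ‖hc.orbitComponent ω.out f‖ ≤ 1 * ‖f‖ := fun f => by
    rw [one_mul]
    exact abs_le_of_sq_le_sq' (le_hasSum (hc.hasSum_norm_sq f) ω fun _ _ => sq_nonneg _)
      (norm_nonneg _) |>.2
  rw [← invariantComplement_eq_orthogonal]
  exact map_mem_invariantComplement ((hc.orbitComponent ω.out).mkContinuous 1 hle)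
    (fun g f => hc.orbitComponent_rep ω.out g f) hf

/-- The averaging is applied to the family of orbits itself, since different orbits may give the
same subgroup and character; multiplicities are then harmless. -/
theorem IsContinuous.hasAlmostInvariantMonomialReps [IsTopologicalGroup G] [LocallyCompactSpace G]
    [T2Space G] [SigmaCompactSpace G] (hc : c.IsContinuous)
    (h : HasAlmostInvariantVectorsIn (c.rep (p := 2) (by norm_num))
      (invariantComplement (c.rep (p := 2) (by norm_num)))) :
    HasAlmostInvariantMonomialReps G := by
  intro K hK ε hε
  obtain ⟨Q, hQ, δ, hδ, hsum⟩ := exists_almost_invariant_summand hK hε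
  obtain ⟨f, hf, hf1, hfQ⟩ := hasAlmostInvariantVectorsIn_iff.1 h Q hQ δ hδ
  have h1 := hc.hasSum_norm_sq f
  rw [hf1, one_pow] at h1
  obtain ⟨F, hF⟩ := (h1.eventually (lt_mem_nhds (show (1 / 2 : ℝ) < 1 by norm_num))).exists
  have h3 : ∀ g ∈ Q, ∑ ω ∈ F, ‖hc.orbitComponent ω.out (c.rep (p := 2) (by norm_num) g f) -
      hc.orbitComponent ω.out f‖ ^ 2 ≤ δ ^ 2 := fun g hg => by
    have h2 := sum_le_hasSum F (fun _ _ => sq_nonneg _)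
      (hc.hasSum_norm_sq (c.rep (p := 2) (by norm_num) g f - f))
    simp only [map_sub] at h2
    exact h2.trans (by have := (hfQ g hg).le; gcongr)
  simp only [hc.orbitComponent_rep] at h3
  obtain ⟨ω, -, u, hu⟩ := hsum F (fun ω : MulAction.orbitRel.Quotient G X =>
      (invariants (indHom (hc.stabilizerChar ω.out)))ᗮ)
    (fun ω => restrictPerp (indHom (hc.stabilizerChar ω.out)))
    (fun ω => ⟨hc.orbitComponent ω.out f, hc.orbitComponent_mem_orthogonal ω hf⟩)
    (fun ω => continuous_restrictPerp (continuous_indHom _) _) hF.le h3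
  exact ⟨⟨hc.openStabilizer ω.out, hc.stabilizerChar ω.out⟩, u, hu⟩

end PhaseCocycle

/-! ### Failure of each property in terms of monomial representations -/

variable {G : Type*} [Group G] [TopologicalSpace G] [IsTopologicalGroup G] [LocallyCompactSpace G]
  [T2Space G] [SigmaCompactSpace G]

theorem one_lt_toReal {p : ℝ≥0∞} (h1 : 1 < p) (h2 : p < ∞) : 1 < p.toReal := by
  have := (ENNReal.toReal_lt_toReal ENNReal.one_ne_top h2.ne).2 h1
  rwa [ENNReal.toReal_one] at this

theorem hasAlmostInvariantMonomialReps_of_not_propertyTlp {p : ℝ≥0∞} [Fact (1 ≤ p)] (h1 : 1 < p)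
    (h2 : p < ∞) (hp2 : p ≠ 2) (h : ¬ PropertyTlp G p) : HasAlmostInvariantMonomialReps G := by
  obtain ⟨π, hπ⟩ : ∃ π : IsomRep G (lp (fun _ : ℕ => ℂ) p),
      HasAlmostInvariantVectorsIn π.toHom (invariantComplement π.toHom) := by
    simpa only [PropertyTlp, PropertyTB, not_forall, not_not] using h
  have hp : 0 < p.toReal := zero_lt_one.trans (one_lt_toReal h1 h2)
  have hp2' : p.toReal ≠ 2 := fun h => hp2 (by
    rw [← ENNReal.ofReal_toReal h2.ne, h]
    simp)
  obtain ⟨_, c, hc⟩ := exists_eq_rep hp hp2' π.toHom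
  rw [← hc] at hπ
  refine (c.isContinuous_of_continuous_rep hp fun f => ?_).hasAlmostInvariantMonomialReps
    (c.hasAlmostInvariantVectorsIn_rep h1 h2 (by norm_num) (by norm_num) hp (by norm_num) hπ)
  rw [hc]
  exact π.continuous_apply f

theorem not_propertyTRmon_iff : ¬ PropertyTRmon G ↔ HasAlmostInvariantMonomialReps G := by
  rw [PropertyTRmon, PropertyTR, not_not]
  exact hasAlmostInvariantVectorsIn_directSum_iff _ fun i v =>
    continuous_restrictPerp (continuous_indHom i.2) v

/-! ### Monomial representations as actions with phases -/

section Extension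

variable {Y X : Type*} {p : ℝ≥0∞} [Fact (1 ≤ p)]

/-- Extension by zero along an injection, as an isometry between `ℓ_p` spaces. -/
def lpExtend (hp : 0 < p.toReal) {j : Y → X} (hj : Function.Injective j) :
    lp (fun _ : Y => ℂ) p →ₗᵢ[ℂ] lp (fun _ : X => ℂ) p :=
  have key : ∀ f : lp (fun _ : Y => ℂ) p,
      HasSum (fun x => ‖Function.extend j f 0 x‖ ^ p.toReal) (‖f‖ ^ p.toReal) := fun f => by
    rw [← hj.hasSum_iff]
    · simpa [Function.comp_def, hj.extend_apply] using lp.hasSum_norm hp f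
    · intro x hx
      rw [Function.extend_apply' _ _ _ hx, Pi.zero_apply, norm_zero, Real.zero_rpow hp.ne']
  { toFun := fun f => ⟨Function.extend j f 0, memℓp_gen (key f).summable⟩
    map_add' := fun f g => lp.ext <| by
      have := Function.extend_add j f g 0 0
      rw [add_zero] at this
      exact this
    map_smul' := fun a f => lp.ext <| by
      have := Function.extend_smul a j f 0
      rw [smul_zero] at this
      exact this
    norm_map' := fun f => by
      refine (Real.rpow_left_inj (norm_nonneg _) (norm_nonneg _) hp.ne').1 ?_
      rw [← (key f).tsum_eq, lp.norm_rpow_eq_tsum hp]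
      rfl }

theorem lpExtend_apply (hp : 0 < p.toReal) {j : Y → X} (hj : Function.Injective j)
    (f : lp (fun _ : Y => ℂ) p) (y : Y) : lpExtend hp hj f (j y) = f y :=
  hj.extend_apply f 0 y

theorem lpExtend_apply_of_notMem (hp : 0 < p.toReal) {j : Y → X} (hj : Function.Injective j)
    (f : lp (fun _ : Y => ℂ) p) {x : X} (hx : x ∉ Set.range j) : lpExtend hp hj f x = 0 :=
  Function.extend_apply' (⇑f) (0 : X → ℂ) x hx

theorem lpExtend_single [DecidableEq Y] [DecidableEq X] (hp : 0 < p.toReal) {j : Y → X}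
    (hj : Function.Injective j) (y : Y) (a : ℂ) :
    lpExtend hp hj (lp.single p y a) = lp.single p (j y) a := by
  refine lp.ext (funext fun x => ?_)
  by_cases hx : x ∈ Set.range j
  · obtain ⟨y', rfl⟩ := hx
    rw [lpExtend_apply]
    rcases eq_or_ne y' y with rfl | hy
    · rw [lp.single_apply_self, lp.single_apply_self]
    · rw [lp.single_apply_ne _ _ _ hy, lp.single_apply_ne _ _ _ (hj.ne hy)]
  · rw [lpExtend_apply_of_notMem hp hj _ hx, lp.single_apply_ne]
    rintro rfl
    exact hx (Set.mem_range_self y)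

theorem lpExtend_rep {G : Type*} [Group G] [MulAction G X] [MulAction G Y] (hp : 0 < p.toReal)
    {j : Y → X} (hj : Function.Injective j) (hjg : ∀ (g : G) y, j (g • y) = g • j y)
    (c : PhaseCocycle G X) (d : PhaseCocycle G Y) (hcd : ∀ g y, c g (j y) = d g y) (g : G)
    (f : lp (fun _ : Y => ℂ) p) : lpExtend hp hj (d.rep hp g f) = c.rep hp g (lpExtend hp hj f) := by
  refine lp.ext (funext fun x => ?_)
  rw [PhaseCocycle.rep_apply]
  by_cases hx : x ∈ Set.range j
  · obtain ⟨y, rfl⟩ := hx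
    rw [lpExtend_apply, ← hjg, lpExtend_apply, PhaseCocycle.rep_apply, hcd]
  · rw [lpExtend_apply_of_notMem hp hj _ hx, lpExtend_apply_of_notMem, mul_zero]
    rintro ⟨y, hy⟩
    exact hx ⟨g • y, by rw [hjg, hy, smul_inv_smul]⟩

end Extension

/-- Finitely supported truncations approximate `f`, and since each `π g` is an isometry they
approximate the orbit map uniformly in `g`. -/
theorem continuous_apply_of_continuous_single {G X : Type*} [Group G] [TopologicalSpace G]
    [DecidableEq X] {p : ℝ≥0∞} [Fact (1 ≤ p)] (hp : p ≠ ∞)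
    (π : G →* (lp (fun _ : X => ℂ) p ≃ₗᵢ[ℂ] lp (fun _ : X => ℂ) p))
    (h : ∀ x (a : ℂ), Continuous fun g => π g (lp.single p x a)) (f : lp (fun _ : X => ℂ) p) :
    Continuous fun g => π g f := by
  refine continuous_of_uniform_approx_of_continuous fun u hu => ?_
  obtain ⟨ε, hε, hεu⟩ := Metric.mem_uniformity_dist.1 hu
  obtain ⟨s, hs⟩ := (Metric.tendsto_nhds.1 (lp.hasSum_single hp f) ε hε).exists
  refine ⟨fun g => π g (∑ x ∈ s, lp.single p x (f x)), ?_, fun g => hεu ?_⟩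
  · simp only [map_sum]
    exact continuous_finsetSum _ fun x _ => h x _
  · rw [LinearIsometryEquiv.dist_map, dist_comm]
    exact hs

namespace PhaseCocycle

variable {G : Type*} [Group G]

/-- The disjoint union of a family of actions with phases. -/
def sigma {ι : Type*} {X : ι → Type*} [∀ i, MulAction G (X i)] (c : ∀ i, PhaseCocycle G (X i)) :
    PhaseCocycle G (Σ i, X i) where
  toFun g x := c x.1 g x.2
  map_mul' g h x := (c x.1).map_mul g h x.2

/-- Transport of a cocycle along a bijection. -/
def comap {X Y : Type*} [MulAction G X] (e : Y ≃ X) (c : PhaseCocycle G X) :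
    letI := e.mulAction G
    PhaseCocycle G Y :=
  letI := e.mulAction G
  { toFun := fun g y => c g (e y)
    map_mul' := fun g h y => by
      rw [c.map_mul, Equiv.smul_def, e.apply_symm_apply] }

end PhaseCocycle

section Induced

variable {G : Type*} [Group G] [TopologicalSpace G] {H : OpenSubgroup G}

theorem out_inv_smul_inv_mul_mem (g : G) (x : G ⧸ (H : Subgroup G)) :
    (g⁻¹ • x).out⁻¹ * (g⁻¹ * x.out) ∈ H := by
  have h := out_inv_mul_mem (H := H) (g⁻¹ * x.out)
  rwa [show ((g⁻¹ * x.out : G) : G ⧸ (H : Subgroup G)) = g⁻¹ • x from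
    congrArg (g⁻¹ • ·) (QuotientGroup.out_eq' x)] at h

/-- The phases of the action of `G` on `Ind_H^G χ` in the basis given by representatives of the
cosets. -/
def indCocycle (χ : H →ₜ* Circle) : PhaseCocycle G (G ⧸ (H : Subgroup G)) where
  toFun g x := (χ ⟨_, out_inv_smul_inv_mul_mem g x⟩)⁻¹
  map_mul' g h x := by
    rw [← mul_inv_rev, ← map_mul]
    congr 2
    refine Subtype.ext ?_
    change _ = (h⁻¹ • g⁻¹ • x).out⁻¹ * (h⁻¹ * (g⁻¹ • x).out) *
      ((g⁻¹ • x).out⁻¹ * (g⁻¹ * x.out))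
    rw [smul_smul, ← mul_inv_rev]
    group

/-- Replacing `g⁻¹ * x.out` by the chosen representative of its coset costs an element of `H`, which
equivariance turns into a phase. -/
theorem equivL2_indHom (χ : H →ₜ* Circle) (g : G) (ξ : IndSpace χ) :
    IndSpace.equivL2 χ (indHom χ g ξ) =
      (indCocycle χ).rep (by norm_num) g (IndSpace.equivL2 χ ξ) := by
  refine lp.ext (funext fun x => ?_)
  change ξ (g⁻¹ * x.out) = ((χ ⟨_, out_inv_smul_inv_mul_mem g x⟩)⁻¹ : Circle) * ξ (g⁻¹ • x).out
  rw [← ξ.apply_mul]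
  simp

/-- The quotient by an open subgroup is discrete, and it is separable because `G` is. This is what
lets the coset spaces fit into `ℕ`. -/
theorem countable_quotient [IsTopologicalGroup G] [SecondCountableTopology G] (H : OpenSubgroup G) :
    Countable (G ⧸ (H : Subgroup G)) := by
  have : DiscreteTopology (G ⧸ (H : Subgroup G)) :=
    QuotientGroup.discreteTopology H.isOpen
  exact TopologicalSpace.separableSpace_iff_countable.1 inferInstance

end Induced

/-! ### Realising monomial representations on `ℓ_p(ℕ)`, and the equivalence -/

section Main

variable {G : Type*} [Group G] [TopologicalSpace G] [IsTopologicalGroup G] [LocallyCompactSpace G]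
  [SecondCountableTopology G]

theorem not_propertyTlp_of_hasAlmostInvariantMonomialReps {p : ℝ≥0∞} [Fact (1 ≤ p)] (h1 : 1 < p)
    (h2 : p < ∞) (h : HasAlmostInvariantMonomialReps G) : ¬ PropertyTlp G p := by
  classical
  have hp : 0 < p.toReal := zero_lt_one.trans (one_lt_toReal h1 h2)
  have htwo : 0 < (2 : ℝ≥0∞).toReal := by norm_num
  let Q := CompactExhaustion.choice G
  choose i u hu huK using fun n : ℕ => h (Q n) (Q.isCompact n) (1 / ((n : ℝ) + 1)) (by positivity)
  have hcount : ∀ n, Countable (G ⧸ ((i n).1 : Subgroup G)) := fun n => countable_quotient _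
  -- One coset for each `n` already makes the union infinite, even if all the quotients are finite;
  -- so it is in bijection with `ℕ`.
  have hinf : Infinite (Σ n, G ⧸ ((i n).1 : Subgroup G)) :=
    Infinite.of_injective (fun n => ⟨n, ((1 : G) : G ⧸ ((i n).1 : Subgroup G))⟩)
      fun a b hab => congrArg Sigma.fst hab
  obtain ⟨e⟩ : Nonempty (ℕ ≃ Σ n, G ⧸ ((i n).1 : Subgroup G)) := nonempty_equiv_of_countable
  let _ := e.mulAction G
  let c : PhaseCocycle G ℕ := (PhaseCocycle.sigma fun n => indCocycle (i n).2).comap e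
  let j : ∀ n, G ⧸ ((i n).1 : Subgroup G) → ℕ := fun n x => e.symm ⟨n, x⟩
  have hj : ∀ n, Function.Injective (j n) := fun n =>
    e.symm.injective.comp sigma_mk_injective
  have hjg : ∀ n (g : G) x, j n (g • x) = g • j n x := fun n g x => by
    rw [Equiv.smul_def, e.apply_symm_apply]
    rfl
  have hcj : ∀ n (g : G) x, c g (j n x) = indCocycle (i n).2 g x := fun n g x => by
    change PhaseCocycle.sigma (fun n => indCocycle (i n).2) g (e (e.symm ⟨n, x⟩)) = _
    rw [e.apply_symm_apply]
    rfl
  let Φ : ∀ n, IndSpace (i n).2 →ₗᵢ[ℂ] lp (fun _ : ℕ => ℂ) 2 := fun n =>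
    (lpExtend htwo (hj n)).comp (IndSpace.equivL2 (i n).2).toLinearIsometry
  have hΦ : ∀ n g ξ, Φ n (indHom (i n).2 g ξ) = c.rep htwo g (Φ n ξ) := fun n g ξ => by
    change lpExtend htwo (hj n) (IndSpace.equivL2 (i n).2 (indHom (i n).2 g ξ)) = _
    rw [equivL2_indHom]
    exact lpExtend_rep htwo (hj n) (hjg n) c _ (hcj n) g _
  -- Each basis vector lies in the image of a single monomial representation, whose continuity is
  -- known.
  have hcont : ∀ f, Continuous fun g => c.rep htwo g f := by
    refine continuous_apply_of_continuous_single (by norm_num) _ fun m a => ?_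
    obtain ⟨⟨n, x⟩, rfl⟩ := e.symm.surjective m
    have hx : lp.single 2 (e.symm ⟨n, x⟩) a =
        Φ n ((IndSpace.equivL2 (i n).2).symm (lp.single 2 x a)) := by
      change _ = lpExtend htwo (hj n) (IndSpace.equivL2 (i n).2 _)
      rw [LinearIsometryEquiv.apply_symm_apply, lpExtend_single]
    rw [hx]
    simp only [← hΦ]
    exact (Φ n).continuous.comp (continuous_indHom _ _)
  have hAI : HasAlmostInvariantVectorsIn (c.rep htwo) (invariantComplement (c.rep htwo)) := by
    refine hasAlmostInvariantVectorsIn_iff.2 fun K hK ε hε => ?_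
    obtain ⟨m, hm⟩ := Q.exists_superset_of_isCompact hK
    obtain ⟨n, hmn, hn⟩ := ((eventually_ge_atTop m).and
      ((tendsto_one_div_add_atTop_nhds_zero_nat (𝕜 := ℝ)).eventually (gt_mem_nhds hε))).exists
    refine ⟨Φ n (u n), ?_, ?_, fun g hg => ?_⟩
    · refine map_mem_invariantComplement (Φ n).toContinuousLinearMap (hΦ n) ?_
      rw [invariantComplement_eq_orthogonal]
      exact (u n).2
    · rw [LinearIsometry.norm_map]
      exact hu n
    · rw [← hΦ, ← map_sub, LinearIsometry.norm_map]
      exact (huK n g (Q.subset hmn (hm hg))).trans hn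
  exact fun hT => hT ⟨c.rep hp, c.continuous_rep_of_exponent htwo hp hcont⟩
    (c.hasAlmostInvariantVectorsIn_rep (by norm_num) (by norm_num) h1 h2 htwo hp hAI)

theorem propertyTlp_iff [T2Space G] {p : ℝ≥0∞} [Fact (1 ≤ p)] (h1 : 1 < p) (h2 : p < ∞) (hp2 : p ≠ 2) :
    PropertyTlp G p ↔ PropertyTRmon G := by
  rw [← not_iff_not, not_propertyTRmon_iff]
  exact ⟨hasAlmostInvariantMonomialReps_of_not_propertyTlp h1 h2 hp2,
    not_propertyTlp_of_hasAlmostInvariantMonomialReps h1 h2⟩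

end Main

end GroupRep

end

theorem theorem1 (G : Type*) [Group G] [TopologicalSpace G] [IsTopologicalGroup G]
    [LocallyCompactSpace G] [T2Space G] [SecondCountableTopology G] :
    ((∃ (p : ℝ≥0∞) (_ : Fact (1 ≤ p)), 1 < p ∧ p < ∞ ∧ p ≠ 2 ∧ GroupRep.PropertyTlp G p) ↔
      GroupRep.PropertyTRmon G) ∧
    ∀ (p q : ℝ≥0∞) [Fact (1 ≤ p)] [Fact (1 ≤ q)], 1 < p → p < ∞ → p ≠ 2 → 1 < q → q < ∞ → q ≠ 2 →
      (GroupRep.PropertyTlp G p ↔ GroupRep.PropertyTlp G q) := by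
  refine ⟨⟨?_, fun h => ?_⟩, ?_⟩
  · rintro ⟨p, _, h1, h2, hp2, hT⟩
    exact (GroupRep.propertyTlp_iff h1 h2 hp2).1 hT
  -- Any exponent in `(1, ∞)` other than `2` would serve.
  · have h3 : (1 : ℝ≥0∞) < 3 := by norm_num
    have : Fact ((1 : ℝ≥0∞) ≤ 3) := ⟨h3.le⟩
    have h32 : (3 : ℝ≥0∞) ≠ 2 := by norm_num
    exact ⟨3, this, h3, by norm_num, h32, (GroupRep.propertyTlp_iff h3 (by norm_num) h32).2 h⟩
  · intro p q _ _ hp1 hp hp2 hq1 hq hq2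
    exact (GroupRep.propertyTlp_iff hp1 hp hp2).trans (GroupRep.propertyTlp_iff hq1 hq hq2).symm
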